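/- Consider terms $t,u ::= x \mid \lambda x.t \mid t\,u \mid t[x/u]$ up to $\alpha$-conversion, where $\lambda x.t$ and $t[x/u]$ bind $x$ in $t$ (but $t[x/u]$ does not bind $x$ in $u$); the object $[x/u]$ is called a jump. The $\lambda$-terms are the terms without jumps. Write $\mathrm{fv}(t)$ for the set of free variables of $t$, $|t|_x$ for the number of free occurrences of $x$ in $t$, and $t\{x/u\}$ for capture-avoiding substitution. As usual, bound variables are renamed so that no rule below captures a free variable. Consider the rules $$\begin{array}{lll} (\mathtt{dB}) & (\lambda x.t)\mathtt{L}\,u \mapsto t[x/u]\mathtt{L} & \mathtt{L}=[x_1/u_1]\ldots[x_k/u_k],\ k\ge 0,\ \{x_1,\ldots,x_k\}\cap \mathrm{fv}(u)=\emptyset\\ (\mathtt{w}) & t[x/u]\mapsto t & \text{if } |t|_x=0\\ (\mathtt{d}) & t[x/u]\mapsto t\{x/u\} & \text{if } |t|_x=1\\ (\mathtt{c}) & t[x/u]\mapsto t_{[y]_x}[x/u][y/u] & \text{if } |t|_x>1 \end{array}$$ where $t_{[y]_x}$ is any term obtained from $t$ by replacing $i$ of the free occurrences of $x$, with $1\le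 i\le |t|_x-1$, by a fresh variable $y$. The inner propagation rules are $$\begin{array}{lll} (\mathtt{in}_1) & (\lambda y.t)[x/u]\mapsto \lambda y.(t[x/u]) & \\ (\mathtt{in}_2) & (t\,v)[x/u]\mapsto t[x/u]\,v & \text{if } x\notin \mathrm{fv}(v)\\ (\mathtt{in}_3) & (t\,v)[x/u]\mapsto t\,(v[x/u]) & \text{if } x\notin \mathrm{fv}(t) \text{ and } x\in \mathrm{fv}(v)\\ (\mathtt{in}_4) & t[y/v][x/u]\mapsto t[y/v[x/u]] & \text{if } x\notin \mathrm{fv}(t) \text{ and } x\in \mathrm{fv}(v) \end{array}$$ and the outer propagation rules are $$\begin{array}{lll} (\mathtt{out}_1) & \lambda y.(t[x/u])\mapsto (\lambda y.t)[x/u] & \text{if } y\notin \mathrm{fv}(u)\\ (\mathtt{out}_2) & t[x/u]\,v\mapsto (t\,v)[x/u] & \\ (\mathtt{out}_3) & t\,(v[x/u])\mapsto (t\,v)[x/u] & \\ (\mathtt{out}_4) & t[y/v[x/u]]\mapsto t[y/v][x/u] & \end{array}$$ Let $\equiv_{\mathtt{CS}}$ be the smallest equivalence relation closed under all contexts that contains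 $t[x/s][y/v]\sim t[y/v][x/s]$ whenever $x\notin \mathrm{fv}(v)$ and $y\notin \mathrm{fv}(s)$. For a relation $\to$ on terms, $\to$ modulo $\equiv_{\mathtt{CS}}$ relates $t$ to $u$ iff $t\equiv_{\mathtt{CS}}t'\to u'\equiv_{\mathtt{CS}}u$ for some $t',u'$. The inner structural $\lambda$-calculus $\lambda\mathtt{j}_{\mathtt{in}}$ is the closure under all contexts of $\mathtt{dB},\mathtt{w},\mathtt{d},\mathtt{c},\mathtt{in}_1,\ldots,\mathtt{in}_4$, modulo $\equiv_{\mathtt{CS}}$; the outer structural $\lambda$-calculus $\lambda\mathtt{j}_{\mathtt{out}}$ is the closure under all contexts of $\mathtt{dB},\mathtt{w},\mathtt{d},\mathtt{c},\mathtt{out}_1,\ldots,\mathtt{out}_4$, modulo $\equiv_{\mathtt{CS}}$. A term is strongly normalizing for a reduction relation if no infinite reduction sequence starts at it. Corollary. Both calculi preserve $\beta$-strong normalization (PSN): every $\lambda$-term that is strongly normalizing for $\beta$-reduction is strongly normalizing for $\lambda\mathtt{j}_{\mathtt{in}}$ and for $\lambda\mathtt{j}_{\mathtt{out}}$. -/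

import Mathlib

namespace StructuralLambda

/-- Terms `t, u ::= x | λx.t | t u | t[x/u]` up to `α`-conversion, in de Bruijn notation.
In `jump t u`, which is `t[x/u]`, the index `0` of `t` is the bound variable `x`, and `u` lies
outside the scope of `x`. -/
inductive Term : Type
  | var : ℕ → Term
  | lam : Term → Term
  | app : Term → Term → Term
  | jump : Term → Term → Term

namespace Term

/-- The `λ`-terms: the terms without jumps. -/
def IsLambda : Term → Prop
  | var _ => True
  | lam t => IsLambda t
  | app t u => IsLambda t ∧ IsLambda u
  | jump _ _ => False

/-- Action of a renaming `ρ` under one binder. -/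
def upRen (ρ : ℕ → ℕ) : ℕ → ℕ
  | 0 => 0
  | n + 1 => ρ n + 1

/-- Capture-avoiding renaming of the free variables. -/
def rename : (ℕ → ℕ) → Term → Term
  | ρ, var n => var (ρ n)
  | ρ, lam t => lam (rename (upRen ρ) t)
  | ρ, app t u => app (rename ρ t) (rename ρ u)
  | ρ, jump t u => jump (rename (upRen ρ) t) (rename ρ u)

/-- Weakening: `t` regarded under one more binder, whose variable is not free in it. A term
under a binder has no free occurrence of the bound variable iff it is of this form. -/
def lift (t : Term) : Term := rename Nat.succ t

/-- Weakening below the innermost binder: the index `0` is kept, and the variable of the next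
binder, of index `1`, is not free in the result. -/
def liftBelow (t : Term) : Term := rename (upRen Nat.succ) t

/-- The transposition of the two innermost bound variables. -/
def swapIdx : ℕ → ℕ
  | 0 => 1
  | 1 => 0
  | n + 2 => n + 2

/-- Exchange of the order of the two innermost binders. -/
def swap (t : Term) : Term := rename swapIdx t

/-- Action of a substitution `σ` under one binder. -/
def upSub (σ : ℕ → Term) : ℕ → Term
  | 0 => var 0
  | n + 1 => lift (σ n)

/-- Capture-avoiding simultaneous substitution. -/
def subst : (ℕ → Term) → Term → Term
  | σ, var n => σ n
  | σ, lam t => lam (subst (upSub σ) t)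
  | σ, app t u => app (subst σ t) (subst σ u)
  | σ, jump t u => jump (subst (upSub σ) t) (subst σ u)

/-- The substitution that replaces the index `0` by `u` and lowers the other indices. -/
def single (u : Term) : ℕ → Term
  | 0 => u
  | n + 1 => var n

/-- The meta-level substitution `t{x/u}`, where `x` is the index `0` of `t`. -/
def inst (t u : Term) : Term := subst (single u) t

/-- The multiplicity `|t|_x`: the number of free occurrences of the variable `x` in the term. -/
def occ : ℕ → Term → ℕ
  | x, var n => if n = x then 1 else 0
  | x, lam t => occ (x + 1) t
  | x, app t u => occ x t + occ x u
  | x, jump t u => occ (x + 1) t + occ x u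

/-- Identification of the two innermost variables `0` and `1`. -/
def mergeIdx : ℕ → ℕ
  | 0 => 0
  | n + 1 => n

/-- `IsSplit t t'` says that `t'` is one of the terms `t_{[y]_x}`: it arises from `t` by replacing
some, but not all, of the free occurrences of `x` (the index `0` of `t`) by a fresh variable `y`.
In `t'` the index `0` is `x` and the index `1` is `y`; identifying `y` with `x` gives back `t`,
and both `x` and `y` occur in `t'`. -/
def IsSplit (t t' : Term) : Prop :=
  rename mergeIdx t' = t ∧ 1 ≤ occ 0 t' ∧ 1 ≤ occ 1 t'

/-- `t L` for a list `L = [x₁/u₁]…[xₖ/uₖ]` of jumps, that is `t[x₁/u₁]…[xₖ/uₖ]`. -/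
def jumps (t : Term) (L : List Term) : Term := L.foldl jump t

end Term

open Term

/-- Closure of a relation by the contexts
`C ::= □ | C v | v C | v[y/C] | C[y/v] | λy.C`. -/
inductive Ctx (R : Term → Term → Prop) : Term → Term → Prop
  | hole {t t' : Term} : R t t' → Ctx R t t'
  | appL {t t' : Term} (v : Term) : Ctx R t t' → Ctx R (app t v) (app t' v)
  | appR {t t' : Term} (v : Term) : Ctx R t t' → Ctx R (app v t) (app v t')
  | jumpR {t t' : Term} (v : Term) : Ctx R t t' → Ctx R (jump v t) (jump v t')
  | jumpL {t t' : Term} (v : Term) : Ctx R t t' → Ctx R (jump t v) (jump t' v)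
  | lam {t t' : Term} : Ctx R t t' → Ctx R (lam t) (lam t')

/-- The `β`-rule `(λx.t) u ↦ t{x/u}`. -/
inductive BetaRule : Term → Term → Prop
  | beta (t u : Term) : BetaRule (app (lam t) u) (inst t u)

/-- `β`-reduction. On `λ`-terms this is ordinary `β`-reduction: a term without jumps only has
redexes in contexts without jumps, and its reducts have no jumps (`Beta.isLambda`). -/
def Beta : Term → Term → Prop := Ctx BetaRule

/-- The rules common to the structural calculi. -/
inductive CoreRule : Term → Term → Prop
  /-- `(λx.t) L u ↦ t[x/u] L`; no jump of `L` binds a variable of `u`. -/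
  | dB (t : Term) (L : List Term) (u : Term) :
      CoreRule (app (jumps (lam t) L) u) (jumps (jump t (rename (fun n => n + L.length) u)) L)
  /-- `t[x/u] ↦ t` if `|t|_x = 0`. -/
  | w (t u : Term) : CoreRule (jump (lift t) u) t
  /-- `t[x/u] ↦ t{x/u}` if `|t|_x = 1`. -/
  | d (t u : Term) : occ 0 t = 1 → CoreRule (jump t u) (inst t u)
  /-- `t[x/u] ↦ t_{[y]_x}[x/u][y/u]` if `|t|_x > 1`. -/
  | c (t t' u : Term) : 1 < occ 0 t → IsSplit t t' →
      CoreRule (jump t u) (jump (jump t' (lift u)) u)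

/-- The inner propagation rules. -/
inductive InRule : Term → Term → Prop
  /-- `(λy.t)[x/u] ↦ λy.(t[x/u])`. -/
  | in1 (t u : Term) : InRule (jump (lam t) u) (lam (jump (swap t) (lift u)))
  /-- `(t v)[x/u] ↦ t[x/u] v` if `x ∉ fv(v)`. -/
  | in2 (t v u : Term) : InRule (jump (app t (lift v)) u) (app (jump t u) v)
  /-- `(t v)[x/u] ↦ t v[x/u]` if `x ∉ fv(t)` and `x ∈ fv(v)`. -/
  | in3 (t v u : Term) : 0 < occ 0 v →
      InRule (jump (app (lift t) v) u) (app t (jump v u))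
  /-- `t[y/v][x/u] ↦ t[y/v[x/u]]` if `x ∉ fv(t)` and `x ∈ fv(v)`. -/
  | in4 (t v u : Term) : 0 < occ 0 v →
      InRule (jump (jump (liftBelow t) v) u) (jump t (jump v u))

/-- The outer propagation rules. -/
inductive OutRule : Term → Term → Prop
  /-- `λy.(t[x/u]) ↦ (λy.t)[x/u]` if `y ∉ fv(u)`. -/
  | out1 (t u : Term) : OutRule (lam (jump t (lift u))) (jump (lam (swap t)) u)
  /-- `t[x/u] v ↦ (t v)[x/u]`. -/
  | out2 (t u v : Term) : OutRule (app (jump t u) v) (jump (app t (lift v)) u)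
  /-- `t v[x/u] ↦ (t v)[x/u]`. -/
  | out3 (t v u : Term) : OutRule (app t (jump v u)) (jump (app (lift t) v) u)
  /-- `t[y/v[x/u]] ↦ t[y/v][x/u]`. -/
  | out4 (t v u : Term) : OutRule (jump t (jump v u)) (jump (jump (liftBelow t) v) u)

/-- The axiom `t[x/s][y/v] ∼ t[y/v][x/s]` if `x ∉ fv(v)` and `y ∉ fv(s)`. -/
inductive CSRule : Term → Term → Prop
  | cs (t s v : Term) :
      CSRule (jump (jump t (lift s)) v) (jump (jump (swap t) (lift v)) s)

/-- The equivalence `≡_CS`: the smallest equivalence closed by contexts that contains the axiom. -/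
def CSEquiv : Term → Term → Prop := Relation.EqvGen (Ctx CSRule)

/-- Reduction `R` modulo `E`: `t E t' R u' E u`. -/
def Modulo (R E : Term → Term → Prop) (t u : Term) : Prop :=
  ∃ t' u', E t t' ∧ R t' u' ∧ E u' u

/-- The inner structural `λ`-calculus: the context closure of `dB, w, d, c, in1, …, in4`,
modulo `≡_CS`. -/
def InnerRed : Term → Term → Prop :=
  Modulo (Ctx fun t u => CoreRule t u ∨ InRule t u) CSEquiv

/-- The outer structural `λ`-calculus: the context closure of `dB, w, d, c, out1, …, out4`,
modulo `≡_CS`. -/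
def OuterRed : Term → Term → Prop :=
  Modulo (Ctx fun t u => CoreRule t u ∨ OutRule t u) CSEquiv

/-- `t` is strongly normalizing: no infinite reduction sequence starts at `t`. -/
def SN (R : Term → Term → Prop) (t : Term) : Prop :=
  ¬ ∃ f : ℕ → Term, f 0 = t ∧ ∀ n, R (f n) (f (n + 1))

/-- Preservation of `β`-strong normalization. -/
def PSN (R : Term → Term → Prop) : Prop :=
  ∀ t : Term, t.IsLambda → SN Beta t → SN R t

theorem Term.IsLambda.rename {t : Term} (ht : t.IsLambda) (ρ : ℕ → ℕ) :
    (t.rename ρ).IsLambda := by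
  induction t generalizing ρ with
  | var n => trivial
  | lam t ih => exact ih ht _
  | app t u iht ihu => exact ⟨iht ht.1 _, ihu ht.2 _⟩
  | jump t u _ _ => exact ht.elim

theorem Term.IsLambda.subst {t : Term} (ht : t.IsLambda) (σ : ℕ → Term)
    (hσ : ∀ n, (σ n).IsLambda) : (t.subst σ).IsLambda := by
  induction t generalizing σ with
  | var n => exact hσ n
  | lam t ih =>
    refine ih ht _ fun n => ?_
    cases n with
    | zero => trivial
    | succ n => exact (hσ n).rename _
  | app t u iht ihu => exact ⟨iht ht.1 _ hσ, ihu ht.2 _ hσ⟩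
  | jump t u _ _ => exact ht.elim

/-- The set of `λ`-terms is closed under `β`-reduction. -/
theorem Beta.isLambda {t u : Term} (h : Beta t u) (ht : t.IsLambda) : u.IsLambda := by
  unfold Beta at h
  induction h with
  | hole h =>
    cases h with
    | beta t u =>
      have hb : t.IsLambda := ht.1
      refine Term.IsLambda.subst hb _ fun n => ?_
      cases n with
      | zero => exact ht.2
      | succ n => trivial
  | appL v _ ih => exact ⟨ih ht.1, ht.2⟩
  | appR v _ ih => exact ⟨ht.1, ih ht.2⟩
  | jumpR v _ _ => exact ht.elim
  | jumpL v _ _ => exact ht.elim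
  | lam _ ih => exact ih ht

end StructuralLambda

/-! The proof measures reduction by intersection types without idempotence. A typing judgement
carries a resource: a multiset of typed variables and a counter to which every application node
contributes one, once for each type at which the node is used. Contexts are upper bounds, so
weakening is free, and every argument of an application or a jump must be typed at least once, even
when its variable does not occur. Hence no subterm of a typed term escapes the typing.

Three facts carry the argument. First, a strongly normalizing `λ`-term is typable (`SN.typable`): by
induction along `β`, it suffices to type a term whose reducts are typable (`typable_of_reducts`),
and a head redex is handled by inverting substitution in typings (`typ_inst`), with an extra type
for the argument in case it is erased.

Second, every rule preserves typings without raising the resource, and `dB` lowers the counter by at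
least one, since it turns an application into a jump, which is not counted (`dB_typLe`,
`InRule.typLe`, `OutRule.typLe`). The equivalence `≡_CS` leaves typings unchanged, and contexts
preserve a decrease because arguments are always typed (`TypLe.ctx`).

Third, all rules except `dB` descend in a lexicographic measure invariant under `≡_CS`. Its first
component, `potential`, counts each jump with the multiplicity that full unfolding can give it, and
it drops under `w` and `d`. Under `c` it does not grow, while the number of jumps, bounded by it,
rises. Propagation does not raise the potential and keeps the number of jumps; there a polynomial
interpretation, one for each calculus, decreases.

The counter of a typing followed by this measure therefore bounds all reductions of a typed term
(`Typ.acc`). -/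

namespace StructuralLambda

/-! ### Intersection types and resources. -/

/-- Intersection types; `arr M A` is the type of functions that use an argument at the types `M`. -/
inductive Ty : Type
  | base : Ty
  | arr : List Ty → Ty → Ty

/-- Resources: a typing context with multiplicities and a counter of application nodes. -/
abbrev Res : Type := Multiset (ℕ × Ty) × ℕ

/-- Extension of a context by the types `M` of a new variable of index `0`. -/
def push (M : Multiset Ty) (G : Res) : Res :=
  (M.map (fun A => (0, A)) + G.1.map (fun p => (p.1 + 1, p.2)), G.2)

/-- Renaming of a context. -/
def renRes (ρ : ℕ → ℕ) : Res →+ Res where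
  toFun G := (G.1.map (fun p => (ρ p.1, p.2)), G.2)
  map_zero' := by simp
  map_add' G H := by simp

/-- Every element of the multiset satisfies `P` with its own share of the resources. -/
def Many {ι : Type} (P : Res → ι → Prop) (K : Res) (s : Multiset ι) : Prop :=
  ∃ l : Multiset (Res × ι), l.map Prod.snd = s ∧ (∀ p ∈ l, P p.1 p.2) ∧ (l.map Prod.fst).sum ≤ K

/-- `Typ t G A`: the term `t` has type `A`, with the resources `G`. -/
def Typ : Term → Res → Ty → Prop
  | .var x, G, A => (x, A) ∈ G.1
  | .lam t, G, B => ∃ (L : List Ty) (A : Ty), B = .arr L A ∧ Typ t (push L G) A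
  | .app t u, K, A => ∃ (L : List Ty) (G H : Res), L ≠ [] ∧ Typ t G (.arr L A) ∧
      Many (Typ u) H (L : Multiset Ty) ∧ G + H + (0, 1) ≤ K
  | .jump t u, K, A => ∃ (M : Multiset Ty) (G H : Res), M ≠ 0 ∧ Typ t (push M G) A ∧
      Many (Typ u) H M ∧ G + H ≤ K

theorem res_zero_le (G : Res) : 0 ≤ G := ⟨Multiset.zero_le _, Nat.zero_le _⟩

/-! ### Sharing resources among the elements of a multiset. -/

section Many

variable {ι κ : Type} {P Q : Res → ι → Prop}

theorem many_zero (K : Res) : Many P K 0 :=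
  ⟨0, by simp, by simp, by rw [Multiset.map_zero, Multiset.sum_zero]; exact res_zero_le K⟩

theorem many_cons {K : Res} {a : ι} {s : Multiset ι} :
    Many P K (a ::ₘ s) ↔ ∃ G H, P G a ∧ Many P H s ∧ G + H ≤ K := by
  classical
  constructor
  · rintro ⟨l, hl, hP, hK⟩
    obtain ⟨p, hp, rfl, hs⟩ := (Multiset.map_eq_cons _ _ _ _).2 hl
    refine ⟨p.1, ((l.erase p).map Prod.fst).sum, hP p hp,
      ⟨_, hs, fun q hq => hP q (Multiset.mem_of_mem_erase hq), le_rfl⟩, ?_⟩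
    rw [← Multiset.cons_erase hp] at hK
    simpa using hK
  · rintro ⟨G, H, ha, ⟨l, rfl, hP, hH⟩, hK⟩
    refine ⟨(G, a) ::ₘ l, by simp, ?_, ?_⟩
    · intro p hp
      obtain rfl | hp := Multiset.mem_cons.1 hp
      exacts [ha, hP p hp]
    · simpa using (add_le_add le_rfl hH).trans hK

theorem Many.mono {G K : Res} {s : Multiset ι} (h : Many P G s) (hK : G ≤ K) : Many P K s := by
  obtain ⟨l, h₁, h₂, h₃⟩ := h
  exact ⟨l, h₁, h₂, h₃.trans hK⟩

theorem many_add {K : Res} {s t : Multiset ι} :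
    Many P K (s + t) ↔ ∃ G H, Many P G s ∧ Many P H t ∧ G + H ≤ K := by
  induction s using Multiset.induction generalizing K with
  | empty =>
    rw [zero_add]
    constructor
    · exact fun h => ⟨0, K, many_zero _, h, by simp⟩
    · rintro ⟨G, H, -, h, hK⟩
      exact h.mono ((le_add_of_nonneg_left (res_zero_le G)).trans hK)
  | cons a s ih =>
    rw [Multiset.cons_add, many_cons]
    simp only [many_cons, ih]
    constructor
    · rintro ⟨G, H, ha, ⟨G', H', hs, ht, h'⟩, hK⟩
      refine ⟨G + G', H', ⟨G, G', ha, hs, le_rfl⟩, ht, ?_⟩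
      rw [add_assoc]
      exact (add_le_add le_rfl h').trans hK
    · rintro ⟨G, H, ⟨G', H', ha, hs, h'⟩, ht, hK⟩
      refine ⟨G', H' + H, ha, ⟨H', H, hs, ht, le_rfl⟩, ?_⟩
      rw [← add_assoc]
      exact (add_le_add h' le_rfl).trans hK

theorem Many.subset {K : Res} {s t : Multiset ι} (h : Many P K t) (hst : s ≤ t) :
    Many P K s := by
  obtain ⟨r, rfl⟩ := Multiset.le_iff_exists_add.1 hst
  obtain ⟨G, H, hs, -, hK⟩ := many_add.1 h
  exact hs.mono ((le_add_of_nonneg_right (res_zero_le H)).trans hK)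

theorem many_singleton {K : Res} {a : ι} (hP : ∀ G K a, P G a → G ≤ K → P K a) :
    Many P K {a} ↔ P K a := by
  rw [← Multiset.cons_zero, many_cons]
  constructor
  · rintro ⟨G, H, ha, -, hK⟩
    exact hP _ _ _ ha ((le_add_of_nonneg_right (res_zero_le H)).trans hK)
  · exact fun h => ⟨K, 0, h, many_zero _, by simp⟩

theorem many_map (f : κ → ι) {K : Res} {s : Multiset κ} :
    Many P K (s.map f) ↔ Many (fun G a => P G (f a)) K s := by
  induction s using Multiset.induction generalizing K with
  | empty => simp [many_zero]
  | cons a s ih => simp only [Multiset.map_cons, many_cons, ih]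

/-- Additivity of `φ` lets the shares of the elements be collected on either side of it. This
extends a statement about one typing of an argument to all the typings that the argument needs. -/
theorem many_iff_of_hom (φ : Res →+ Res) (hφ : Monotone φ)
    (h : ∀ K a, P K a ↔ ∃ G, φ G ≤ K ∧ Q G a) {K : Res} {s : Multiset ι} :
    Many P K s ↔ ∃ G, φ G ≤ K ∧ Many Q G s := by
  induction s using Multiset.induction generalizing K with
  | empty =>
    simp only [many_zero, and_true, true_iff]
    exact ⟨0, by rw [map_zero]; exact res_zero_le K⟩
  | cons a s ih =>
    simp only [many_cons, ih, h]
    constructor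
    · rintro ⟨G, H, ⟨G', hG, ha⟩, ⟨H', hH, hs⟩, hK⟩
      exact ⟨G' + H', by rw [map_add]; exact (add_le_add hG hH).trans hK,
        G', H', ha, hs, le_rfl⟩
    · rintro ⟨G, hG, G', H', ha, hs, hK⟩
      exact ⟨φ G', φ H', ⟨G', le_rfl, ha⟩, ⟨H', le_rfl, hs⟩, by
        rw [← map_add]; exact (hφ hK).trans hG⟩

end Many

open Term

/-! ### Contexts under a binder. -/

section Push

theorem push_fst (M : Multiset Ty) (G : Res) :
    (push M G).1 = M.map (fun A => (0, A)) + G.1.map (fun p => (p.1 + 1, p.2)) := rfl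

theorem push_add (M N : Multiset Ty) (G H : Res) :
    push (M + N) (G + H) = push M G + push N H := by
  refine Prod.ext ?_ rfl
  simp only [push, Multiset.map_add, Prod.fst_add]
  abel

theorem push_zero_add (M : Multiset Ty) (G H : Res) :
    push M (G + H) = push M G + push 0 H := by
  rw [← push_add, add_zero]

/-- A pure counter is unaffected by a binder. It can thus be absorbed into a `push`, after which
`push_le_push` compares the bound variable and the rest separately. -/
theorem push_counter (n : ℕ) : push 0 (0, n) = (0, n) := by simp [push]

theorem filterMap_none {ι κ : Type} (s : Multiset ι) :
    s.filterMap (fun _ => (none : Option κ)) = 0 := by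
  induction s using Multiset.induction with
  | empty => rfl
  | cons a s ih => rwa [Multiset.filterMap_cons_none _ _ rfl]

theorem counter_le {m n : ℕ} (h : m ≤ n) : ((0, m) : Res) ≤ (0, n) := ⟨le_rfl, h⟩

theorem push_le_push {M N : Multiset Ty} {G H : Res} :
    push M G ≤ push N H ↔ M ≤ N ∧ G ≤ H := by
  constructor
  · rintro ⟨h₁, h₂⟩
    refine ⟨?_, ?_, h₂⟩
    -- Filtering by index recovers the two summands of the context: index `0` gives `M`, the
    -- positive indices give `G`.
    · have := Multiset.filterMap_le_filterMap
        (fun p : ℕ × Ty => if p.1 = 0 then some p.2 else none) h₁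
      simpa [push, Multiset.filterMap_add, Multiset.filterMap_map, Function.comp_def,
        filterMap_none] using this
    · have := Multiset.filterMap_le_filterMap
        (fun p : ℕ × Ty => if p.1 = 0 then none else some (p.1 - 1, p.2)) h₁
      simpa [push, Multiset.filterMap_add, Multiset.filterMap_map, Function.comp_def,
        filterMap_none] using this
  · rintro ⟨h₁, h₂, h₃⟩
    exact ⟨add_le_add (Multiset.map_le_map h₁) (Multiset.map_le_map h₂), h₃⟩

theorem push_zero_zero : push 0 0 = 0 := rfl

theorem exists_eq_push (G : Res) : ∃ M H, G = push M H := by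
  obtain ⟨Γ, n⟩ := G
  induction Γ using Multiset.induction with
  | empty => exact ⟨0, (0, n), by simp [push]⟩
  | cons p Γ ih =>
    obtain ⟨M, H, h⟩ := ih
    obtain ⟨h₁, h₂⟩ := Prod.ext_iff.1 h
    obtain ⟨x, A⟩ := p
    cases x with
    | zero => exact ⟨A ::ₘ M, H, Prod.ext (by simpa [push] using h₁) h₂⟩
    | succ x =>
      exact ⟨M, ((x, A) ::ₘ H.1, H.2), Prod.ext (by simpa [push] using h₁) h₂⟩

theorem renRes_mono (ρ : ℕ → ℕ) : Monotone (renRes ρ) :=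
  fun _ _ h => ⟨Multiset.map_le_map h.1, h.2⟩

theorem renRes_fst (ρ : ℕ → ℕ) (G : Res) :
    (renRes ρ G).1 = G.1.map (fun p => (ρ p.1, p.2)) := rfl

theorem renRes_upRen_push (ρ : ℕ → ℕ) (M : Multiset Ty) (G : Res) :
    renRes (upRen ρ) (push M G) = push M (renRes ρ G) := by
  refine Prod.ext ?_ rfl
  simp [renRes_fst, push, upRen]

theorem renRes_counter (ρ : ℕ → ℕ) (n : ℕ) : renRes ρ (0, n) = (0, n) := rfl

theorem renRes_succ (G : Res) : renRes Nat.succ G = push 0 G := by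
  refine Prod.ext ?_ rfl
  simp [renRes, push]

end Push

/-! ### Typing under renaming and substitution. -/

theorem Typ.mono {t : Term} {G K : Res} {A : Ty} (h : Typ t G A) (hK : G ≤ K) : Typ t K A := by
  induction t generalizing G K A with
  | var x => exact Multiset.mem_of_le hK.1 h
  | lam t ih =>
    obtain ⟨L, A, rfl, h⟩ := h
    exact ⟨L, A, rfl, ih h (push_le_push.2 ⟨le_rfl, hK⟩)⟩
  | app t u _ _ =>
    obtain ⟨L, G, H, h₁, h₂, h₃, h₄⟩ := h
    exact ⟨L, G, H, h₁, h₂, h₃, h₄.trans hK⟩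
  | jump t u _ _ =>
    obtain ⟨L, G, H, h₁, h₂, h₃, h₄⟩ := h
    exact ⟨L, G, H, h₁, h₂, h₃, h₄.trans hK⟩

/-- The slack in `≤` absorbs the assumptions of `K` on which the term does not depend. No
injectivity of `ρ` is needed, so weakening, exchange and the identification of two variables are all
instances, each with its inverse. -/
theorem typ_rename {t : Term} {ρ : ℕ → ℕ} {K : Res} {A : Ty} :
    Typ (rename ρ t) K A ↔ ∃ G, renRes ρ G ≤ K ∧ Typ t G A := by
  induction t generalizing ρ K A with
  | var x =>
    constructor
    · intro h
      refine ⟨({(x, A)}, 0), ⟨?_, Nat.zero_le _⟩, by simp [Typ]⟩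
      exact Multiset.singleton_le.2 h
    · rintro ⟨G, hG, h⟩
      exact Multiset.mem_of_le hG.1 (Multiset.mem_map_of_mem (fun p : ℕ × Ty => (ρ p.1, p.2)) h)
  | lam t ih =>
    simp only [rename, Typ, ih]
    constructor
    · rintro ⟨L, B, rfl, G, hG, h⟩
      obtain ⟨M, H, rfl⟩ := exists_eq_push G
      rw [renRes_upRen_push, push_le_push] at hG
      -- The premise may use fewer types of the bound variable than `L` offers; weakening restores
      -- `L`.
      exact ⟨H, hG.2, L, B, rfl, h.mono (push_le_push.2 ⟨hG.1, le_rfl⟩)⟩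
    · rintro ⟨G, hG, L, B, rfl, h⟩
      refine ⟨L, B, rfl, _, ?_, h⟩
      rw [renRes_upRen_push, push_le_push]
      exact ⟨le_rfl, hG⟩
  | app t u iht ihu =>
    have hu := @many_iff_of_hom _ _ _ (renRes ρ) (renRes_mono ρ) (@ihu ρ)
    simp only [rename, Typ, iht, hu]
    constructor
    · rintro ⟨L, G, H, hL, ⟨G', hG, ht⟩, ⟨H', hH, hs⟩, hK⟩
      refine ⟨G' + H' + (0, 1), ?_, L, G', H', hL, ht, hs, le_rfl⟩
      rw [map_add, map_add, renRes_counter]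
      exact (add_le_add (add_le_add hG hH) le_rfl).trans hK
    · rintro ⟨G, hG, L, G', H', hL, ht, hs, hK⟩
      refine ⟨L, _, _, hL, ⟨G', le_rfl, ht⟩, ⟨H', le_rfl, hs⟩, ?_⟩
      rw [← renRes_counter ρ, ← map_add, ← map_add]
      exact (renRes_mono ρ hK).trans hG
  | jump t u iht ihu =>
    have hu := @many_iff_of_hom _ _ _ (renRes ρ) (renRes_mono ρ) (@ihu ρ)
    simp only [rename, Typ, iht, hu]
    constructor
    · rintro ⟨M, G, H, hM, ⟨G', hG, ht⟩, ⟨H', hH, hs⟩, hK⟩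
      obtain ⟨N, G', rfl⟩ := exists_eq_push G'
      rw [renRes_upRen_push, push_le_push] at hG
      refine ⟨G' + H', ?_, M, G', H', hM, ht.mono (push_le_push.2 ⟨hG.1, le_rfl⟩), hs, le_rfl⟩
      rw [map_add]
      exact (add_le_add hG.2 hH).trans hK
    · rintro ⟨G, hG, M, G', H', hM, ht, hs, hK⟩
      refine ⟨M, renRes ρ G', _, hM, ⟨push M G', ?_, ht⟩, ⟨H', le_rfl, hs⟩, ?_⟩
      · rw [renRes_upRen_push]
      · rw [← map_add]
        exact (renRes_mono ρ hK).trans hG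

theorem many_typ_rename {t : Term} {ρ : ℕ → ℕ} {K : Res} {M : Multiset Ty} :
    Many (Typ (rename ρ t)) K M ↔ ∃ G, renRes ρ G ≤ K ∧ Many (Typ t) G M :=
  many_iff_of_hom (Q := Typ t) _ (renRes_mono ρ) fun _ _ => typ_rename

theorem typ_lift_push {t : Term} {M : Multiset Ty} {G : Res} {A : Ty} :
    Typ (lift t) (push M G) A ↔ Typ t G A := by
  rw [lift, typ_rename]
  constructor
  · rintro ⟨H, hH, h⟩
    rw [renRes_succ, push_le_push] at hH
    exact h.mono hH.2
  · intro h
    refine ⟨G, ?_, h⟩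
    rw [renRes_succ, push_le_push]
    exact ⟨Multiset.zero_le _, le_rfl⟩

theorem many_typ_lift {t : Term} {K : Res} {M : Multiset Ty} :
    Many (Typ (lift t)) K M ↔ ∃ G, push 0 G ≤ K ∧ Many (Typ t) G M := by
  rw [lift, many_typ_rename]
  simp only [renRes_succ]

/-- The resources `K` type the terms that `σ` substitutes for the variables of a context. -/
def TypSub (σ : ℕ → Term) : Res → Multiset (ℕ × Ty) → Prop :=
  Many fun G p => Typ (σ p.1) G p.2

/-- Under a binder the new variable is replaced by itself, so its types `M` are paid for by exactly
the assumptions `push M 0`. The other terms are lifted and use none of these assumptions. -/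
theorem typSub_upSub {σ : ℕ → Term} {K : Res} {M : Multiset Ty} {G : Res} :
    TypSub (upSub σ) K (push M G).1 ↔ ∃ H, push M H ≤ K ∧ TypSub σ H G.1 := by
  have hvar : ∀ (K : Res) (M : Multiset Ty),
      Many (fun G A => Typ (var 0) G A) K M ↔ push M 0 ≤ K := by
    intro K M
    induction M using Multiset.induction generalizing K with
    | empty => simpa only [many_zero, push_zero_zero, true_iff] using res_zero_le K
    | cons A M ih =>
      simp only [many_cons, ih]
      have hA : push (A ::ₘ M) 0 = (({(0, A)}, 0) : Res) + push M 0 := by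
        refine Prod.ext ?_ rfl
        simp [push]
      rw [hA]
      constructor
      · rintro ⟨G, H, h, hH, hK⟩
        refine (add_le_add ?_ hH).trans hK
        exact ⟨by simpa [Typ] using h, Nat.zero_le _⟩
      · intro h
        exact ⟨_, _, by simp [Typ], le_rfl, h⟩
  have hlift : ∀ K : Res, Many (fun G p => Typ (lift (σ p.1)) G p.2) K G.1 ↔
      ∃ H, renRes Nat.succ H ≤ K ∧ TypSub σ H G.1 := fun K =>
    many_iff_of_hom (Q := fun G (p : ℕ × Ty) => Typ (σ p.1) G p.2) _ (renRes_mono _) fun _ _ => typ_rename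
  simp only [TypSub, push_fst, many_add, many_map, upSub, hvar, hlift, renRes_succ]
  constructor
  · rintro ⟨G₁, G₂, h₁, ⟨H, hH, h⟩, hK⟩
    refine ⟨H, ?_, h⟩
    have := (add_le_add h₁ hH).trans hK
    rwa [← push_add, zero_add, add_zero] at this
  · rintro ⟨H, hK, h⟩
    refine ⟨push M 0, push 0 H, le_rfl, ⟨H, le_rfl, h⟩, ?_⟩
    rwa [← push_add, zero_add, add_zero]

theorem many_typ_subst {u : Term} {σ : ℕ → Term}
    (hu : ∀ K A, Typ (subst σ u) K A ↔
      ∃ G H, TypSub σ H G.1 ∧ Typ u G A ∧ H + (0, G.2) ≤ K) {K : Res} {M : Multiset Ty} :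
    Many (Typ (subst σ u)) K M ↔
      ∃ G H, TypSub σ H G.1 ∧ Many (Typ u) G M ∧ H + (0, G.2) ≤ K := by
  have hc : ∀ (a b : ℕ), ((0, a + b) : Res) = (0, a) + (0, b) := fun a b => by simp
  induction M using Multiset.induction generalizing K with
  | empty =>
    simp only [many_zero, true_and, true_iff]
    exact ⟨0, 0, many_zero _, (add_zero (0 : Res)).trans_le (res_zero_le K)⟩
  | cons A M ih =>
    simp only [many_cons, ih, hu]
    constructor
    · rintro ⟨K₁, K₂, ⟨G₁, H₁, hs₁, h₁, hK₁⟩, ⟨G₂, H₂, hs₂, h₂, hK₂⟩, hK⟩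
      refine ⟨G₁ + G₂, H₁ + H₂, many_add.2 ⟨_, _, hs₁, hs₂, le_rfl⟩, ⟨_, _, h₁, h₂, le_rfl⟩, ?_⟩
      rw [Prod.snd_add, hc, add_add_add_comm]
      exact (add_le_add hK₁ hK₂).trans hK
    · rintro ⟨G, H, hs, ⟨G₁, G₂, h₁, h₂, hG⟩, hK⟩
      obtain ⟨H₁, H₂, hs₁, hs₂, hH⟩ := many_add.1 (hs.subset hG.1)
      refine ⟨_, _, ⟨G₁, H₁, hs₁, h₁, le_rfl⟩, ⟨G₂, H₂, hs₂, h₂, le_rfl⟩, ?_⟩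
      rw [add_add_add_comm, ← hc]
      exact (add_le_add hH (counter_le hG.2)).trans hK

/-- Substitution and its inverse are one equivalence. The assumptions in `G` are traded for the
resources `H` of the substituted terms, so only the counter of `G` survives next to `H`.
Multiplicities make this exact: each use of a variable pays for its own copy. -/
theorem typ_subst {t : Term} {σ : ℕ → Term} {K : Res} {A : Ty} :
    Typ (subst σ t) K A ↔ ∃ G H, TypSub σ H G.1 ∧ Typ t G A ∧ H + (0, G.2) ≤ K := by
  have hc : ∀ (a b : ℕ), ((0, a + b) : Res) = (0, a) + (0, b) := fun a b => by simp
  have hone : ∀ {σ : ℕ → Term} {K : Res} {x : ℕ} {A : Ty}, TypSub σ K {(x, A)} ↔ Typ (σ x) K A :=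
    many_singleton fun _ _ _ h hK => h.mono hK
  induction t generalizing σ K A with
  | var x =>
    constructor
    · intro h
      exact ⟨({(x, A)}, 0), K, hone.2 h, by simp [Typ], by simp⟩
    · rintro ⟨G, H, hs, h, hK⟩
      have := hone.1 (hs.subset (Multiset.singleton_le.2 h))
      exact this.mono ((le_add_of_nonneg_right (res_zero_le _)).trans hK)
  | lam t ih =>
    simp only [subst, Typ, ih]
    constructor
    · rintro ⟨L, B, rfl, G, H, hs, h, hK⟩
      obtain ⟨M, G, rfl⟩ := exists_eq_push G
      obtain ⟨H', hH', hs⟩ := typSub_upSub.1 hs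
      have := (add_le_add hH' (le_refl ((0, (push M G).2) : Res))).trans hK
      rw [← push_counter, ← push_zero_add, push_le_push] at this
      exact ⟨G, H', hs, ⟨L, B, rfl, h.mono (push_le_push.2 ⟨this.1, le_rfl⟩)⟩, this.2⟩
    · rintro ⟨G, H, hs, ⟨L, B, rfl, h⟩, hK⟩
      refine ⟨L, B, rfl, _, push L H, typSub_upSub.2 ⟨H, le_rfl, hs⟩, h, ?_⟩
      rw [← push_counter, ← push_zero_add, push_le_push]
      exact ⟨le_rfl, hK⟩
  | app t u iht ihu =>
    have hu := @many_typ_subst u σ (fun _ _ => ihu)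
    simp only [subst, Typ, iht, hu]
    constructor
    · rintro ⟨L, K₁, K₂, hL, ⟨G₁, H₁, hs₁, h₁, hK₁⟩, ⟨G₂, H₂, hs₂, h₂, hK₂⟩, hK⟩
      refine ⟨G₁ + G₂ + (0, 1), H₁ + H₂, ?_, ⟨L, _, _, hL, h₁, h₂, le_rfl⟩, ?_⟩
      · have : TypSub σ (H₁ + H₂) (G₁.1 + G₂.1) := many_add.2 ⟨_, _, hs₁, hs₂, le_rfl⟩
        simpa only [Prod.fst_add, add_zero] using this
      · refine le_trans ?_ ((add_le_add (add_le_add hK₁ hK₂) le_rfl).trans hK)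
        simp only [Prod.snd_add, hc]
        rw [← add_assoc, add_add_add_comm]
    · rintro ⟨G, H, hs, ⟨L, G₁, G₂, hL, h₁, h₂, hG⟩, hK⟩
      have hG' : G₁.1 + G₂.1 ≤ G.1 := by simpa using hG.1
      obtain ⟨H₁, H₂, hs₁, hs₂, hH⟩ := many_add.1 (hs.subset hG')
      refine ⟨L, _, _, hL, ⟨G₁, H₁, hs₁, h₁, le_rfl⟩, ⟨G₂, H₂, hs₂, h₂, le_rfl⟩, ?_⟩
      rw [add_add_add_comm, ← hc, add_assoc, ← hc]
      exact (add_le_add hH (counter_le hG.2)).trans hK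
  | jump t u iht ihu =>
    have hu := @many_typ_subst u σ (fun _ _ => ihu)
    simp only [subst, Typ, iht, hu]
    constructor
    · rintro ⟨M, K₁, K₂, hM, ⟨G₁, H₁, hs₁, h₁, hK₁⟩, ⟨G₂, H₂, hs₂, h₂, hK₂⟩, hK⟩
      obtain ⟨N, G₁, rfl⟩ := exists_eq_push G₁
      obtain ⟨H', hH', hs₁⟩ := typSub_upSub.1 hs₁
      have := (add_le_add hH' (le_refl ((0, (push N G₁).2) : Res))).trans hK₁
      rw [← push_counter, ← push_zero_add, push_le_push] at this
      refine ⟨G₁ + G₂, H' + H₂, many_add.2 ⟨_, _, hs₁, hs₂, le_rfl⟩,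
        ⟨M, _, _, hM, h₁.mono (push_le_push.2 ⟨this.1, le_rfl⟩), h₂, le_rfl⟩, ?_⟩
      rw [Prod.snd_add, hc, add_add_add_comm]
      exact (add_le_add this.2 hK₂).trans hK
    · rintro ⟨G, H, hs, ⟨M, G₁, G₂, hM, h₁, h₂, hG⟩, hK⟩
      obtain ⟨H₁, H₂, hs₁, hs₂, hH⟩ := many_add.1 (hs.subset hG.1)
      refine ⟨M, H₁ + (0, G₁.2), _, hM,
        ⟨push M G₁, push M H₁, typSub_upSub.2 ⟨_, le_rfl, hs₁⟩, h₁, ?_⟩,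
        ⟨G₂, H₂, hs₂, h₂, le_rfl⟩, ?_⟩
      · rw [← push_counter, ← push_zero_add]
        rfl
      · rw [add_add_add_comm, ← hc]
        exact (add_le_add hH (counter_le hG.2)).trans hK

theorem typSub_single {u : Term} {K : Res} {M : Multiset Ty} {G : Res} :
    TypSub (single u) K (push M G).1 ↔ ∃ H, Many (Typ u) H M ∧ H + (G.1, 0) ≤ K := by
  have hvar : ∀ (K : Res) (s : Multiset (ℕ × Ty)),
      Many (fun G p => Typ (var p.1) G p.2) K s ↔ (s, 0) ≤ K := by
    intro K s
    induction s using Multiset.induction generalizing K with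
    | empty => exact iff_of_true (many_zero _) (res_zero_le K)
    | cons p s ih =>
      simp only [many_cons, ih]
      have hp : ((p ::ₘ s, 0) : Res) = ({p}, 0) + (s, 0) := by simp
      rw [hp]
      constructor
      · rintro ⟨G, H, h, hH, hK⟩
        refine (add_le_add ?_ hH).trans hK
        exact ⟨by simpa [Typ] using h, Nat.zero_le _⟩
      · intro h
        exact ⟨_, _, by simp [Typ], le_rfl, h⟩
  simp only [TypSub, push_fst, many_add, many_map, single, hvar]
  constructor
  · rintro ⟨H, H', h, h', hK⟩
    exact ⟨H, h, (add_le_add le_rfl h').trans hK⟩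
  · rintro ⟨H, h, hK⟩
    exact ⟨H, _, h, le_rfl, hK⟩

/-- Substitution and its inverse for typing. -/
theorem typ_inst {t u : Term} {K : Res} {A : Ty} :
    Typ (inst t u) K A ↔
      ∃ M G H, Typ t (push M G) A ∧ Many (Typ u) H M ∧ G + H ≤ K := by
  rw [inst, typ_subst]
  have hG : ∀ (M : Multiset Ty) (G H : Res), H + (G.1, 0) + (0, (push M G).2) = G + H := by
    intro M G H
    refine Prod.ext ?_ ?_
    · simp [add_comm]
    · simp [push, add_comm]
  constructor
  · rintro ⟨G, H, hs, h, hK⟩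
    obtain ⟨M, G, rfl⟩ := exists_eq_push G
    obtain ⟨H', hu, hH⟩ := typSub_single.1 hs
    refine ⟨M, G, H', h, hu, ?_⟩
    rw [← hG M]
    exact (add_le_add hH le_rfl).trans hK
  · rintro ⟨M, G, H, h, hu, hK⟩
    refine ⟨push M G, _, typSub_single.2 ⟨H, hu, le_rfl⟩, h, ?_⟩
    rwa [hG]

/-! ### Composition of renamings and symmetry of the exchange axiom. -/

theorem upRen_comp (ρ τ : ℕ → ℕ) : upRen ρ ∘ upRen τ = upRen (ρ ∘ τ) := by
  funext x
  cases x <;> rfl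

theorem rename_rename (ρ τ : ℕ → ℕ) (t : Term) :
    rename ρ (rename τ t) = rename (ρ ∘ τ) t := by
  induction t generalizing ρ τ with
  | var x => rfl
  | lam t ih => simp only [rename, ih, upRen_comp]
  | app t u iht ihu => simp only [rename, iht, ihu]
  | jump t u iht ihu => simp only [rename, iht, ihu, upRen_comp]

theorem rename_id (t : Term) : rename id t = t := by
  have hup : upRen id = id := by
    funext x
    cases x <;> rfl
  induction t with
  | var x => rfl
  | lam t ih => simp only [rename, hup, ih]
  | app t u iht ihu => simp only [rename, iht, ihu]
  | jump t u iht ihu => simp only [rename, hup, iht, ihu]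

theorem swap_swap (t : Term) : swap (swap t) = t := by
  have hswap : swapIdx ∘ swapIdx = id := by
    funext x
    rcases x with _ | _ | x <;> rfl
  rw [swap, swap, rename_rename, hswap, rename_id]

theorem CSRule.symm {t t' : Term} (h : CSRule t t') : CSRule t' t := by
  obtain ⟨t, s, v⟩ := h
  have := CSRule.cs (swap t) v s
  rwa [swap_swap] at this

/-! ### Subject reduction with a decreasing counter. -/

section Typing

theorem Many.imp {ι : Type} {P Q : Res → ι → Prop} (h : ∀ K a, P K a → Q K a) {K : Res}
    {s : Multiset ι} (hs : Many P K s) : Many Q K s := by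
  obtain ⟨l, h₁, h₂, h₃⟩ := hs
  exact ⟨l, h₁, fun p hp => h _ _ (h₂ p hp), h₃⟩

theorem Typ.jump_intro {t u : Term} {M : Multiset Ty} {G H K : Res} {A : Ty} (hM : M ≠ 0)
    (ht : Typ t (push M G) A) (hu : Many (Typ u) H M) (hK : G + H ≤ K) :
    Typ (jump t u) K A :=
  ⟨M, G, H, hM, ht, hu, hK⟩

theorem typ_lift {t : Term} {K : Res} {A : Ty} :
    Typ (lift t) K A ↔ ∃ G, push 0 G ≤ K ∧ Typ t G A := by
  rw [lift, typ_rename]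
  simp only [renRes_succ]

theorem typ_swap {t : Term} {L M : Multiset Ty} {G : Res} {A : Ty}
    (h : Typ t (push L (push M G)) A) : Typ (swap t) (push M (push L G)) A := by
  refine typ_rename.2 ⟨_, le_of_eq ?_, h⟩
  refine Prod.ext ?_ rfl
  simp only [renRes_fst, push_fst, Multiset.map_add, Multiset.map_map, Function.comp_def, swapIdx]
  abel

theorem typ_liftBelow {t : Term} {M : Multiset Ty} {K : Res} {A : Ty} :
    Typ (liftBelow t) (push M K) A ↔ ∃ G, push 0 G ≤ K ∧ Typ t (push M G) A := by
  rw [liftBelow, typ_rename]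
  constructor
  · rintro ⟨G, hG, h⟩
    obtain ⟨N, G, rfl⟩ := exists_eq_push G
    rw [renRes_upRen_push, renRes_succ, push_le_push] at hG
    exact ⟨G, hG.2, h.mono (push_le_push.2 ⟨hG.1, le_rfl⟩)⟩
  · rintro ⟨G, hG, h⟩
    refine ⟨_, ?_, h⟩
    rw [renRes_upRen_push, renRes_succ, push_le_push]
    exact ⟨le_rfl, hG⟩

theorem ne_zero_of_mem_push {B : Ty} {M : Multiset Ty} {G : Res} (h : (0, B) ∈ (push M G).1) :
    M ≠ 0 := by
  rintro rfl
  simp [push_fst] at h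

theorem mem_of_succ_mem_push {x : ℕ} {B : Ty} {M : Multiset Ty} {G : Res}
    (h : (x + 1, B) ∈ (push M G).1) : (x, B) ∈ G.1 := by
  simpa [push_fst] using h

/-- A variable that occurs in a typed term occurs in the context. -/
theorem Typ.exists_mem_of_occ {t : Term} {x : ℕ} {G : Res} {A : Ty} (h : Typ t G A)
    (hx : 0 < occ x t) : ∃ B, (x, B) ∈ G.1 := by
  have hmany : ∀ {u : Term} {x : ℕ} {M : Multiset Ty} {H : Res},
      (∀ {G A}, Typ u G A → ∃ B, (x, B) ∈ G.1) → M ≠ 0 → Many (Typ u) H M →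
      ∃ B, (x, B) ∈ H.1 := by
    intro u x M H hu hM h
    obtain ⟨a, ha⟩ := Multiset.exists_mem_of_ne_zero hM
    obtain ⟨s, rfl⟩ := Multiset.exists_cons_of_mem ha
    obtain ⟨G, G', h, -, hH⟩ := many_cons.1 h
    obtain ⟨B, hB⟩ := hu h
    exact ⟨B, Multiset.mem_of_le ((Multiset.le_add_right _ _).trans hH.1) hB⟩
  induction t generalizing x G A with
  | var y =>
    by_cases hxy : y = x
    · subst hxy
      exact ⟨A, h⟩
    · simp [occ, hxy] at hx
  | lam t ih =>
    obtain ⟨L, A, rfl, h⟩ := h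
    obtain ⟨B, hB⟩ := ih h hx
    exact ⟨B, mem_of_succ_mem_push hB⟩
  | app t u iht ihu =>
    obtain ⟨L, G, H, hL, ht, hu, hK⟩ := h
    have hK₁ : G.1 + H.1 ≤ _ := (Multiset.le_add_right _ _).trans hK.1
    rcases Nat.add_pos_iff_pos_or_pos.1 hx with hx | hx
    · obtain ⟨B, hB⟩ := iht ht hx
      exact ⟨B, Multiset.mem_of_le ((Multiset.le_add_right _ _).trans hK₁) hB⟩
    · obtain ⟨B, hB⟩ := hmany (fun h => ihu h hx) (by simpa using hL) hu
      exact ⟨B, Multiset.mem_of_le ((Multiset.le_add_left _ _).trans hK₁) hB⟩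
  | jump t u iht ihu =>
    obtain ⟨M, G, H, hM, ht, hu, hK⟩ := h
    rcases Nat.add_pos_iff_pos_or_pos.1 hx with hx | hx
    · obtain ⟨B, hB⟩ := iht ht hx
      exact ⟨B, Multiset.mem_of_le ((Multiset.le_add_right _ _).trans hK.1)
        (mem_of_succ_mem_push hB)⟩
    · obtain ⟨B, hB⟩ := hmany (fun h => ihu h hx) hM hu
      exact ⟨B, Multiset.mem_of_le ((Multiset.le_add_left _ _).trans hK.1) hB⟩

/-- The types `M` are distributed among the typings of `v`. Each of these must receive a nonempty
share for its own jump, which holds because the jump variable occurs in `v`; this is where the side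
conditions of `in3` and `in4` enter the typing argument. -/
theorem many_typ_jump {v u : Term} {M L : Multiset Ty} {G H : Res} (hocc : 0 < occ 0 v)
    (hv : Many (Typ v) (push M G) L) (hu : Many (Typ u) H M) :
    Many (Typ (jump v u)) (G + H) L := by
  induction L using Multiset.induction generalizing M G H with
  | empty => exact many_zero _
  | cons A L ih =>
    obtain ⟨G₁, G₂, h₁, h₂, hG⟩ := many_cons.1 hv
    obtain ⟨M₁, G₁, rfl⟩ := exists_eq_push G₁
    obtain ⟨M₂, G₂, rfl⟩ := exists_eq_push G₂
    rw [← push_add, push_le_push] at hG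
    obtain ⟨H₁, H₂, hu₁, hu₂, hH⟩ := many_add.1 (hu.subset hG.1)
    obtain ⟨B, hB⟩ := h₁.exists_mem_of_occ hocc
    refine many_cons.2 ⟨_, _, .jump_intro (ne_zero_of_mem_push hB) h₁ hu₁ le_rfl,
      ih h₂ hu₂, ?_⟩
    rw [add_add_add_comm]
    exact add_le_add hG.2 hH

/-- The jumps in the several typings merge into one by adding their shares. No occurrence condition
is needed, because nonempty multisets have a nonempty sum; this is why `out3` and `out4` are sound
without one. -/
theorem exists_of_many_typ_jump {v u : Term} {L : Multiset Ty} {K : Res} (hL : L ≠ 0)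
    (h : Many (Typ (jump v u)) K L) :
    ∃ M G H, M ≠ 0 ∧ Many (Typ v) (push M G) L ∧ Many (Typ u) H M ∧ G + H ≤ K := by
  have key : ∀ {K}, Many (Typ (jump v u)) K L →
      ∃ M G H, Many (Typ v) (push M G) L ∧ Many (Typ u) H M ∧ G + H ≤ K ∧
        (L ≠ 0 → M ≠ 0) := by
    clear h hL
    induction L using Multiset.induction with
    | empty =>
      exact fun {K} _ => ⟨0, 0, 0, many_zero _, many_zero _, (add_zero (0 : Res)).trans_le
        (res_zero_le K), id⟩
    | cons A L ih =>
      intro K h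
      obtain ⟨K₁, K₂, ⟨M₁, G₁, H₁, hM₁, hv₁, hu₁, hK₁⟩, h₂, hK⟩ := many_cons.1 h
      obtain ⟨M₂, G₂, H₂, hv₂, hu₂, hK₂, -⟩ := ih h₂
      refine ⟨M₁ + M₂, G₁ + G₂, H₁ + H₂, many_cons.2 ⟨_, _, hv₁, hv₂, (push_add _ _ _ _).ge⟩,
        many_add.2 ⟨_, _, hu₁, hu₂, le_rfl⟩, ?_, fun _ h => hM₁ (by simp_all)⟩
      rw [add_add_add_comm]
      exact (add_le_add hK₁ hK₂).trans hK
  obtain ⟨M, G, H, hv, hu, hK, hM⟩ := key h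
  exact ⟨M, G, H, hM hL, hv, hu, hK⟩

/-- Every typing of `t` gives one of `t'` whose counter is lower by at least `d`. -/
def TypLe (d : ℕ) (t t' : Term) : Prop :=
  ∀ K A, Typ t K A → ∃ G, G + (0, d) ≤ K ∧ Typ t' G A

theorem TypLe.typ {d : ℕ} {t t' : Term} (h : TypLe d t t') {K : Res} {A : Ty} (ht : Typ t K A) :
    Typ t' K A := by
  obtain ⟨G, hG, h⟩ := h K A ht
  exact h.mono ((le_add_of_nonneg_right (res_zero_le _)).trans hG)

theorem typLe_zero {t t' : Term} (h : ∀ K A, Typ t K A → Typ t' K A) : TypLe 0 t t' :=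
  fun K A ht => ⟨K, (add_zero K).le, h K A ht⟩

/-- One element of `M` yields the decrease `d`, and the remaining typings do not get more expensive.
For `M = 0` there would be nothing to decrease. -/
theorem TypLe.many {d : ℕ} {t t' : Term} (h : TypLe d t t') {K : Res} {M : Multiset Ty}
    (hM : M ≠ 0) (ht : Many (Typ t) K M) : ∃ G, G + (0, d) ≤ K ∧ Many (Typ t') G M := by
  obtain ⟨A, hA⟩ := Multiset.exists_mem_of_ne_zero hM
  obtain ⟨s, rfl⟩ := Multiset.exists_cons_of_mem hA
  obtain ⟨G, H, h₁, h₂, hK⟩ := many_cons.1 ht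
  obtain ⟨G', hG, h₁⟩ := h _ _ h₁
  refine ⟨G' + H, ?_, many_cons.2 ⟨_, _, h₁, h₂.imp fun _ _ => h.typ, le_rfl⟩⟩
  rw [add_right_comm]
  exact (add_le_add hG le_rfl).trans hK

theorem TypLe.push {d : ℕ} {t t' : Term} (h : TypLe d t t') {K : Res} {M : Multiset Ty} {A : Ty}
    (ht : Typ t (push M K) A) : ∃ G, G + (0, d) ≤ K ∧ Typ t' (StructuralLambda.push M G) A := by
  obtain ⟨G, hG, ht⟩ := h _ _ ht
  obtain ⟨N, G, rfl⟩ := exists_eq_push G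
  rw [← push_counter, ← push_zero_add, push_le_push] at hG
  exact ⟨G, hG.2, ht.mono (push_le_push.2 ⟨hG.1, le_rfl⟩)⟩

theorem TypLe.ctx {d : ℕ} {R : Term → Term → Prop} (hR : ∀ t t', R t t' → TypLe d t t')
    {t t' : Term} (h : Ctx R t t') : TypLe d t t' := by
  induction h with
  | hole h => exact hR _ _ h
  | appL v _ ih =>
    rintro K A ⟨L, G, H, hL, ht, hv, hK⟩
    obtain ⟨G', hG, ht⟩ := ih _ _ ht
    refine ⟨G' + H + (0, 1), ?_, L, G', H, hL, ht, hv, le_rfl⟩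
    refine le_trans (le_of_eq ?_) ((add_le_add (add_le_add hG le_rfl) le_rfl).trans hK)
    abel
  | appR v _ ih =>
    rintro K A ⟨L, G, H, hL, ht, hv, hK⟩
    obtain ⟨H', hH, hv⟩ := ih.many (by simpa using hL) hv
    refine ⟨G + H' + (0, 1), ?_, L, G, H', hL, ht, hv, le_rfl⟩
    refine le_trans (le_of_eq ?_) ((add_le_add (add_le_add le_rfl hH) le_rfl).trans hK)
    abel
  | jumpR v _ ih =>
    rintro K A ⟨M, G, H, hM, ht, hv, hK⟩
    obtain ⟨H', hH, hv⟩ := ih.many hM hv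
    refine ⟨G + H', ?_, M, G, H', hM, ht, hv, le_rfl⟩
    rw [add_assoc]
    exact (add_le_add le_rfl hH).trans hK
  | jumpL v _ ih =>
    rintro K A ⟨M, G, H, hM, ht, hv, hK⟩
    obtain ⟨G', hG, ht⟩ := ih.push ht
    refine ⟨G' + H, ?_, M, G', H, hM, ht, hv, le_rfl⟩
    rw [add_right_comm]
    exact (add_le_add hG le_rfl).trans hK
  | lam _ ih =>
    rintro K _ ⟨L, A, rfl, h⟩
    obtain ⟨G, hG, ht⟩ := ih.push h
    exact ⟨G, hG, L, A, rfl, ht⟩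

theorem CSRule.typ {t t' : Term} (h : CSRule t t') {K : Res} {A : Ty} (ht : Typ t K A) :
    Typ t' K A := by
  obtain ⟨t, s, v⟩ := h
  obtain ⟨M, G, H, hM, ⟨N, G₁, G₂, hN, ht, hs, hG⟩, hv, hK⟩ := ht
  obtain ⟨H', hH', hs⟩ := many_typ_lift.1 hs
  obtain ⟨M', G₁, rfl⟩ := exists_eq_push G₁
  have := (add_le_add le_rfl hH').trans hG
  rw [← push_zero_add, push_le_push] at this
  have ht := typ_swap (ht.mono (push_le_push.2 ⟨le_rfl, push_le_push.2 ⟨this.1, le_refl G₁⟩⟩))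
  refine .jump_intro hN (.jump_intro hM ht (many_typ_lift.2 ⟨H, le_rfl, hv⟩)
    (push_zero_add _ _ _).ge) hs ?_
  rw [add_right_comm]
  exact (add_le_add this.2 le_rfl).trans hK

theorem CSEquiv.typ_iff {t t' : Term} (h : CSEquiv t t') {K : Res} {A : Ty} :
    Typ t K A ↔ Typ t' K A := by
  have hsymm : ∀ {t t' : Term}, Ctx CSRule t t' → Ctx CSRule t' t := by
    intro t t' h
    induction h with
    | hole h => exact .hole h.symm
    | appL v _ ih => exact .appL v ih
    | appR v _ ih => exact .appR v ih
    | jumpR v _ ih => exact .jumpR v ih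
    | jumpL v _ ih => exact .jumpL v ih
    | lam _ ih => exact .lam ih
  have hctx : ∀ {t t' : Term}, Ctx CSRule t t' → Typ t K A → Typ t' K A := fun h =>
    (TypLe.ctx (fun _ _ h => typLe_zero fun _ _ => h.typ) h).typ
  induction h with
  | rel _ _ h => exact ⟨hctx h, hctx (hsymm h)⟩
  | refl => exact Iff.rfl
  | symm _ _ _ ih => exact ih.symm
  | trans _ _ _ _ _ ih₁ ih₂ => exact ih₁.trans ih₂

theorem jumps_append_singleton (t : Term) (L : List Term) (a : Term) :
    jumps t (L ++ [a]) = jump (jumps t L) a := by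
  simp [jumps]

/-- The induction peels off the outermost jump of `L`. The argument `u` then moves under one more
binder and is lifted, which adds up to the shift by `L.length`. -/
theorem typ_jumps_jump {t u : Term} {L : List Term} {M : List Ty} {G H : Res} {A : Ty}
    (hM : M ≠ []) (ht : Typ (jumps (lam t) L) G (.arr M A))
    (hu : Many (Typ u) H (M : Multiset Ty)) :
    Typ (jumps (jump t (rename (fun n => n + L.length) u)) L) (G + H) A := by
  induction L using List.reverseRecOn generalizing u G H with
  | nil =>
    obtain ⟨M', A', hMA, ht⟩ := ht
    obtain ⟨rfl, rfl⟩ := Ty.arr.inj hMA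
    have : rename (fun n => n + 0) u = u := rename_id u
    exact .jump_intro (by simpa using hM) ht (this.symm ▸ hu) le_rfl
  | append_singleton L a ih =>
    rw [jumps_append_singleton] at ht ⊢
    obtain ⟨N, G₁, G₂, hN, ht, ha, hG⟩ := ht
    have := ih ht (many_typ_lift.2 ⟨H, le_rfl, hu⟩)
    rw [lift, rename_rename, ← push_zero_add] at this
    have hL : (fun n => n + L.length) ∘ Nat.succ = fun n => n + (L ++ [a]).length := by
      funext n
      simp
      omega
    rw [hL] at this
    refine .jump_intro hN this ha ?_
    rw [add_right_comm]
    exact add_le_add hG le_rfl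

/-- A typing is pulled back along the identification of `x` and `y`. Both variables occur in `t'`,
so each receives a nonempty multiset, as the two jumps produced by `c` require. -/
theorem typ_split {t t' : Term} {M : Multiset Ty} {G : Res} {A : Ty} (h : IsSplit t t')
    (ht : Typ t (push M G) A) :
    ∃ M₀ M₁, M₀ ≠ 0 ∧ M₁ ≠ 0 ∧ M₀ + M₁ ≤ M ∧ Typ t' (push M₀ (push M₁ G)) A := by
  obtain ⟨rfl, h₀, h₁⟩ := h
  obtain ⟨G', hG, ht⟩ := typ_rename.1 ht
  obtain ⟨M₀, G', rfl⟩ := exists_eq_push G'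
  obtain ⟨M₁, G', rfl⟩ := exists_eq_push G'
  have hmerge : renRes mergeIdx (push M₀ (push M₁ G')) = push (M₀ + M₁) G' := by
    refine Prod.ext ?_ rfl
    simp only [renRes_fst, push_fst, Multiset.map_add, Multiset.map_map, Function.comp_def,
      mergeIdx]
    abel
  rw [hmerge, push_le_push] at hG
  obtain ⟨B₀, hB₀⟩ := ht.exists_mem_of_occ h₀
  obtain ⟨B₁, hB₁⟩ := ht.exists_mem_of_occ h₁
  exact ⟨M₀, M₁, ne_zero_of_mem_push hB₀, ne_zero_of_mem_push (mem_of_succ_mem_push hB₁), hG.1,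
    ht.mono (push_le_push.2 ⟨le_rfl, push_le_push.2 ⟨le_rfl, hG.2⟩⟩)⟩

theorem dB_typLe (t : Term) (L : List Term) (u : Term) :
    TypLe 1 (app (jumps (lam t) L) u)
      (jumps (jump t (rename (fun n => n + L.length) u)) L) := by
  rintro K A ⟨M, G, H, hM, ht, hu, hK⟩
  -- The unit that the rule for applications adds to the counter is exactly what is saved.
  exact ⟨G + H, hK, typ_jumps_jump hM ht hu⟩

theorem w_typLe (t u : Term) : TypLe 0 (jump (lift t) u) t := by
  refine typLe_zero ?_
  rintro K A ⟨M, G, H, hM, ht, hu, hK⟩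
  exact (typ_lift_push.1 ht).mono ((le_add_of_nonneg_right (res_zero_le _)).trans hK)

theorem d_typLe (t u : Term) : TypLe 0 (jump t u) (inst t u) := by
  refine typLe_zero ?_
  rintro K A ⟨M, G, H, hM, ht, hu, hK⟩
  exact typ_inst.2 ⟨M, G, H, ht, hu, hK⟩

theorem c_typLe {t t' : Term} (u : Term) (h : IsSplit t t') :
    TypLe 0 (jump t u) (jump (jump t' (lift u)) u) := by
  refine typLe_zero ?_
  rintro K A ⟨M, G, H, hM, ht, hu, hK⟩
  obtain ⟨M₀, M₁, h₀, h₁, hM', ht⟩ := typ_split h ht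
  obtain ⟨H₀, H₁, hu₀, hu₁, hH⟩ := many_add.1 (hu.subset hM')
  refine .jump_intro h₁ (.jump_intro h₀ ht (many_typ_lift.2 ⟨H₀, le_rfl, hu₀⟩)
    (push_zero_add _ _ _).ge) hu₁ ?_
  rw [add_assoc]
  exact (add_le_add le_rfl hH).trans hK

theorem InRule.typLe {t t' : Term} (h : InRule t t') : TypLe 0 t t' := by
  refine typLe_zero ?_
  cases h with
  | in1 t u =>
    rintro K _ ⟨M, G, H, hM, ⟨L, A, rfl, ht⟩, hu, hK⟩
    refine ⟨L, A, rfl, .jump_intro hM (typ_swap ht) (many_typ_lift.2 ⟨H, le_rfl, hu⟩) ?_⟩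
    rw [← push_zero_add, push_le_push]
    exact ⟨le_rfl, hK⟩
  | in2 t v u =>
    rintro K A ⟨M, G, H, hM, ⟨L, G₁, G₂, hL, ht, hv, hG⟩, hu, hK⟩
    obtain ⟨G₂', hG₂, hv⟩ := many_typ_lift.1 hv
    obtain ⟨N, G₁, rfl⟩ := exists_eq_push G₁
    have := (add_le_add (add_le_add le_rfl hG₂) le_rfl).trans hG
    rw [← push_zero_add, ← push_counter, ← push_zero_add, push_le_push] at this
    refine ⟨L, _, _, hL, .jump_intro hM (ht.mono (push_le_push.2 ⟨this.1, le_rfl⟩)) hu le_rfl,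
      hv, le_trans (le_of_eq ?_) ((add_le_add this.2 le_rfl).trans hK)⟩
    abel
  | in3 t v u hocc =>
    rintro K A ⟨M, G, H, hM, ⟨L, G₁, G₂, hL, ht, hv, hG⟩, hu, hK⟩
    obtain ⟨G₁', hG₁, ht⟩ := typ_lift.1 ht
    obtain ⟨N, G₂, rfl⟩ := exists_eq_push G₂
    have := (add_le_add (add_le_add hG₁ le_rfl) le_rfl).trans hG
    rw [← push_add, ← push_counter, ← push_add, push_le_push, zero_add, add_zero] at this
    refine ⟨L, _, _, hL, ht, many_typ_jump hocc hv (hu.subset this.1),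
      le_trans (le_of_eq ?_) ((add_le_add this.2 le_rfl).trans hK)⟩
    abel
  | in4 t v u hocc =>
    rintro K A ⟨M, G, H, hM, ⟨N, G₁, G₂, hN, ht, hv, hG⟩, hu, hK⟩
    obtain ⟨G₁', hG₁, ht⟩ := typ_liftBelow.1 ht
    obtain ⟨M', G₂, rfl⟩ := exists_eq_push G₂
    have := (add_le_add hG₁ le_rfl).trans hG
    rw [← push_add, push_le_push, zero_add] at this
    refine .jump_intro hN ht (many_typ_jump hocc hv (hu.subset this.1)) ?_
    rw [← add_assoc]
    exact (add_le_add this.2 le_rfl).trans hK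

theorem OutRule.typLe {t t' : Term} (h : OutRule t t') : TypLe 0 t t' := by
  refine typLe_zero ?_
  cases h with
  | out1 t u =>
    rintro K _ ⟨L, A, rfl, ⟨M, G, H, hM, ht, hu, hK⟩⟩
    obtain ⟨H', hH, hu⟩ := many_typ_lift.1 hu
    obtain ⟨N, G, rfl⟩ := exists_eq_push G
    have := (add_le_add le_rfl hH).trans hK
    rw [← push_zero_add, push_le_push] at this
    exact .jump_intro hM ⟨L, A, rfl, (typ_swap ht).mono
      (push_le_push.2 ⟨this.1, le_rfl⟩)⟩ hu this.2
  | out2 t u v =>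
    rintro K A ⟨L, G, G', hL, ⟨M, G₁, H, hM, ht, hu, hG⟩, hv, hK⟩
    refine .jump_intro (G := G₁ + G' + (0, 1)) hM
      ⟨L, _, _, hL, ht, many_typ_lift.2 ⟨G', le_rfl, hv⟩, ?_⟩ hu ?_
    · rw [← push_zero_add, ← push_counter, ← push_zero_add, push_counter]
    · refine le_trans (le_of_eq ?_) ((add_le_add (add_le_add hG le_rfl) le_rfl).trans hK)
      abel
  | out3 t v u =>
    rintro K A ⟨L, G, G', hL, ht, hv, hK⟩
    obtain ⟨M, G₁, H, hM, hv, hu, hG⟩ := exists_of_many_typ_jump (by simpa using hL) hv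
    refine .jump_intro (G := G + G₁ + (0, 1)) hM
      ⟨L, _, _, hL, typ_lift.2 ⟨G, le_rfl, ht⟩, hv, ?_⟩ hu ?_
    · rw [← push_add, ← push_counter, ← push_add, zero_add, add_zero, push_counter]
    · refine le_trans (le_of_eq ?_) ((add_le_add (add_le_add le_rfl hG) le_rfl).trans hK)
      abel
  | out4 t v u =>
    rintro K A ⟨N, G, G', hN, ht, hv, hK⟩
    obtain ⟨M, G₁, H, hM, hv, hu, hG⟩ := exists_of_many_typ_jump hN hv
    refine .jump_intro (G := G + G₁) hM
      (.jump_intro hN (typ_liftBelow.2 ⟨G, le_rfl, ht⟩) hv ?_) hu ?_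
    · rw [← push_add, zero_add]
    · rw [add_assoc]
      exact (add_le_add le_rfl hG).trans hK

end Typing

/-! ### Typability of strongly normalizing `λ`-terms. -/

/-- A term is typable. -/
def Typable (t : Term) : Prop := ∃ K A, Typ t K A

theorem exists_of_many {u : Term} {K : Res} {M : Multiset Ty} (hM : M ≠ 0)
    (h : Many (Typ u) K M) : Typable u := by
  obtain ⟨A, hA⟩ := Multiset.exists_mem_of_ne_zero hM
  obtain ⟨s, rfl⟩ := Multiset.exists_cons_of_mem hA
  obtain ⟨G, H, h₁, -⟩ := many_cons.1 h
  exact ⟨G, A, h₁⟩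

theorem typ_app_singleton {t u : Term} {A B : Ty} {G H : Res} (ht : Typ t G (.arr [B] A))
    (hu : Typ u H B) : Typ (app t u) (G + H + (0, 1)) A :=
  ⟨[B], G, H, by simp, ht, (many_singleton fun _ _ _ h hK => h.mono hK).2 hu, le_rfl⟩

/-- Inverting the substitution may leave no type for the argument, when it is erased. Adding one
type `B` of `u` makes the list nonempty, and weakening lets the body ignore it. This is why the
argument must be typable by itself. -/
theorem exists_typ_beta {t u : Term} (hu : Typable u) {K : Res} {A : Ty}
    (h : Typ (inst t u) K A) : ∃ G, Typ (app (lam t) u) G A := by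
  obtain ⟨M, G, H, ht, hM, -⟩ := typ_inst.1 h
  obtain ⟨H', B, hu⟩ := hu
  refine ⟨_, (B ::ₘ M).toList, G, H' + H, ?_, ⟨_, _, rfl, ?_⟩, ?_, le_rfl⟩
  · simp
  · rw [Multiset.coe_toList]
    exact ht.mono (push_le_push.2 ⟨Multiset.le_cons_self _ _, le_rfl⟩)
  · rw [Multiset.coe_toList]
    exact many_cons.2 ⟨_, _, hu, hM, le_rfl⟩

/-- A `λ`-term with typable reducts is typable; if it is not an abstraction, it has every type,
or it has the types of one of its reducts. -/
theorem typable_of_reducts {t : Term} (ht : t.IsLambda) (h : ∀ t', Beta t t' → Typable t') :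
    Typable t ∧ ((∃ a, t = lam a) ∨ (∀ A, ∃ G, Typ t G A) ∨
      ∃ t', Beta t t' ∧ ∀ A, (∃ G, Typ t' G A) → ∃ G, Typ t G A) := by
  induction t with
  | var x =>
    have hx : ∀ A, ∃ G, Typ (var x) G A := fun A => ⟨({(x, A)}, 0), by simp [Typ]⟩
    exact ⟨(hx .base).elim fun G hG => ⟨G, .base, hG⟩, .inr (.inl hx)⟩
  | lam t ih =>
    obtain ⟨⟨K, A, hK⟩, -⟩ := ih ht fun t' h' => by
      obtain ⟨K, _, L, A, -, hK⟩ := h _ (.lam h')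
      exact ⟨_, _, hK⟩
    obtain ⟨M, G, rfl⟩ := exists_eq_push K
    refine ⟨⟨G, .arr M.toList A, M.toList, A, rfl, ?_⟩, .inl ⟨t, rfl⟩⟩
    rwa [Multiset.coe_toList]
  | app t u iht ihu =>
    -- A reduct of `u` gives a reduct of the application, and the condition `L ≠ []` means that the
    -- typing of the latter types the former.
    obtain ⟨hu, -⟩ := ihu ht.2 fun u' h' => by
      obtain ⟨K, A, L, G, H, hL, -, hu, -⟩ := h _ (.appR t h')
      exact exists_of_many (by simpa using hL) hu
    obtain ⟨-, h₁⟩ := iht ht.1 fun t' h' => by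
      obtain ⟨K, A, L, G, H, -, ht, -⟩ := h _ (.appL u h')
      exact ⟨_, _, ht⟩
    have hred : ∀ t', Beta (app t u) t' → (∀ A, (∃ G, Typ t' G A) → ∃ G, Typ (app t u) G A) →
        Typable (app t u) ∧ ((∃ a, app t u = lam a) ∨ (∀ A, ∃ G, Typ (app t u) G A) ∨
          ∃ t', Beta (app t u) t' ∧ ∀ A, (∃ G, Typ t' G A) → ∃ G, Typ (app t u) G A) := by
      intro t' h' hA
      obtain ⟨K, A, hK⟩ := h t' h'
      obtain ⟨G, hG⟩ := hA A ⟨K, hK⟩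
      exact ⟨⟨G, A, hG⟩, .inr (.inr ⟨t', h', hA⟩)⟩
    -- The function part decides: an abstraction makes the term a redex; a function with every type
    -- accepts an argument of type `B` and returns any type; otherwise the typings come from the
    -- reduct in function position.
    obtain ⟨a, rfl⟩ | h₁ | ⟨t', h', hA⟩ := h₁
    · exact hred _ (.hole (.beta a u)) fun A ⟨G, hG⟩ => exists_typ_beta hu hG
    · obtain ⟨H, B, hu⟩ := hu
      have hall : ∀ A, ∃ G, Typ (app t u) G A := fun A => by
        obtain ⟨G, hG⟩ := h₁ (.arr [B] A)
        exact ⟨_, typ_app_singleton hG hu⟩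
      exact ⟨(hall .base).elim fun G hG => ⟨G, .base, hG⟩, .inr (.inl hall)⟩
    · refine hred _ (.appL u h') ?_
      rintro A ⟨G, L, G₁, G₂, hL, ht', hu', -⟩
      obtain ⟨G₁', hG⟩ := hA _ ⟨_, ht'⟩
      exact ⟨_, L, G₁', G₂, hL, hG, hu', le_rfl⟩
  | jump t u _ _ => exact ht.elim

theorem SN.acc {R : Term → Term → Prop} {t : Term} (h : SN R t) : Acc (fun a b => R b a) t := by
  by_contra hacc
  obtain ⟨f, h₀, hf⟩ := not_acc_iff_exists_descending_chain.1 hacc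
  exact h ⟨f, h₀, hf⟩

theorem SN.of_acc {R : Term → Term → Prop} {t : Term} (h : Acc (fun a b => R b a) t) : SN R t :=
  fun ⟨f, h₀, hf⟩ => not_acc_iff_exists_descending_chain.2 ⟨f, h₀, hf⟩ h

theorem SN.typable {t : Term} (ht : t.IsLambda) (h : SN Beta t) : Typable t := by
  induction h.acc with
  | intro t _ ih =>
    refine (typable_of_reducts ht fun t' h' => ih t' h' (h'.isLambda ht) ?_).1
    rintro ⟨f, h₀, hf⟩
    refine h ⟨fun n => Nat.casesOn n t f, rfl, fun n => ?_⟩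
    cases n with
    | zero =>
      rw [← h₀] at h'
      exact h'
    | succ n => exact hf n

/-! ### Termination of the rules other than `dB`. -/

section Termination

/-- Weights of variables under one more binder, whose variable has weight `n`. -/
def consWeight (n : ℕ) (w : ℕ → ℕ) : ℕ → ℕ
  | 0 => n
  | x + 1 => w x

/-- The number of occurrences of variables, weighted by `w`, that the full unfolding of the jumps
can create; a jump whose variable does not occur is counted as if it occurred once. -/
def weight : (ℕ → ℕ) → Term → ℕ
  | w, var x => w x
  | w, lam t => weight (consWeight 0 w) t
  | w, app t u => weight w t + weight w u
  | w, jump t u =>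
    weight (consWeight 0 w) t + max 1 (weight (consWeight 1 0) t) * weight w u

/-- The potential multiplicity of a jump with body `t`. -/
def mult (t : Term) : ℕ := max 1 (weight (consWeight 1 0) t)

/-- The number of jumps, each counted with its potential multiplicity. -/
def potential : Term → ℕ
  | var _ => 0
  | lam t => potential t
  | app t u => potential t + potential u
  | jump t u => potential t + mult t * (1 + potential u)

/-- The number of jumps. -/
def numJumps : Term → ℕ
  | var _ => 0
  | lam t => numJumps t
  | app t u => numJumps t + numJumps u
  | jump t u => numJumps t + 1 + numJumps u

theorem one_le_mult (t : Term) : 1 ≤ mult t := le_max_left _ _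

theorem weight_lam (w : ℕ → ℕ) (t : Term) : weight w (lam t) = weight (consWeight 0 w) t := rfl

theorem weight_app (w : ℕ → ℕ) (t u : Term) : weight w (app t u) = weight w t + weight w u := rfl

theorem weight_jump (w : ℕ → ℕ) (t u : Term) :
    weight w (jump t u) = weight (consWeight 0 w) t + mult t * weight w u := rfl

theorem numJumps_le_potential (t : Term) : numJumps t ≤ potential t := by
  induction t with
  | var x => exact le_rfl
  | lam t ih => exact ih
  | app t u iht ihu => exact add_le_add iht ihu
  | jump t u iht ihu =>
    have := Nat.le_mul_of_pos_left (1 + potential u) (one_le_mult t)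
    simp only [numJumps, potential]
    omega

theorem consWeight_comp_upRen (n : ℕ) (w : ℕ → ℕ) (ρ : ℕ → ℕ) :
    consWeight n w ∘ upRen ρ = consWeight n (w ∘ ρ) := by
  funext x
  cases x <;> rfl

theorem consWeight_comp_succ (n : ℕ) (w : ℕ → ℕ) : consWeight n w ∘ Nat.succ = w := rfl

theorem consWeight_zero_zero : consWeight 0 0 = 0 := by
  funext x
  cases x <;> rfl

theorem consWeight_add (m n : ℕ) (w v : ℕ → ℕ) :
    consWeight (m + n) (w + v) = consWeight m w + consWeight n v := by
  funext x
  cases x <;> rfl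

theorem weight_rename (w : ℕ → ℕ) (ρ : ℕ → ℕ) (t : Term) :
    weight w (rename ρ t) = weight (w ∘ ρ) t := by
  induction t generalizing w ρ with
  | var x => rfl
  | lam t ih => simp only [rename, weight, ih, consWeight_comp_upRen]
  | app t u iht ihu => simp only [rename, weight, iht, ihu]
  | jump t u iht ihu =>
    have h0 : (0 : ℕ → ℕ) ∘ ρ = 0 := rfl
    simp only [rename, weight, iht, ihu, consWeight_comp_upRen, h0]

theorem weight_zero (t : Term) : weight 0 t = 0 := by
  induction t with
  | var x => rfl
  | lam t ih => simpa only [weight, consWeight_zero_zero] using ih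
  | app t u iht ihu => simp only [weight, iht, ihu]
  | jump t u iht ihu => simp only [weight, consWeight_zero_zero, iht, ihu, mul_zero, add_zero]

/-- Weights are linear in `w` because the multiplicity of a jump is computed from its bound variable
alone, independently of `w`. -/
theorem weight_add (w v : ℕ → ℕ) (t : Term) :
    weight (w + v) t = weight w t + weight v t := by
  induction t generalizing w v with
  | var x => rfl
  | lam t ih => simpa only [weight, ← consWeight_add] using ih (consWeight 0 w) (consWeight 0 v)
  | app t u iht ihu =>
    simp only [weight, iht, ihu]
    omega
  | jump t u iht ihu =>
    have := iht (consWeight 0 w) (consWeight 0 v)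
    rw [← consWeight_add, zero_add] at this
    simp only [weight, this, ihu, mul_add]
    omega

theorem weight_mul (n : ℕ) (w : ℕ → ℕ) (t : Term) :
    weight (fun x => n * w x) t = n * weight w t := by
  induction n with
  | zero => simp only [zero_mul]; exact weight_zero t
  | succ n ih =>
    have : (fun x => (n + 1) * w x) = (fun x => n * w x) + w := by
      funext x
      simp [add_mul]
    rw [this, weight_add, ih, add_mul, one_mul]

theorem weight_lift (n : ℕ) (w : ℕ → ℕ) (t : Term) :
    weight (consWeight n w) (lift t) = weight w t := by
  rw [lift, weight_rename, consWeight_comp_succ]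

theorem mult_rename_upRen (ρ : ℕ → ℕ) (t : Term) : mult (rename (upRen ρ) t) = mult t := by
  have h0 : (0 : ℕ → ℕ) ∘ ρ = 0 := rfl
  rw [mult, weight_rename, consWeight_comp_upRen, h0, mult]

theorem mult_lift (t : Term) : mult (lift t) = 1 := by
  rw [mult, weight_lift, weight_zero]
  rfl

theorem potential_rename (ρ : ℕ → ℕ) (t : Term) : potential (rename ρ t) = potential t := by
  induction t generalizing ρ with
  | var x => rfl
  | lam t ih => exact ih _
  | app t u iht ihu => simp only [rename, potential, iht, ihu]
  | jump t u iht ihu => simp only [rename, potential, iht, ihu, mult_rename_upRen]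

theorem numJumps_rename (ρ : ℕ → ℕ) (t : Term) : numJumps (rename ρ t) = numJumps t := by
  induction t generalizing ρ with
  | var x => rfl
  | lam t ih => exact ih _
  | app t u iht ihu => simp only [rename, numJumps, iht, ihu]
  | jump t u iht ihu => simp only [rename, numJumps, iht, ihu]

theorem weight_upSub (n : ℕ) (w : ℕ → ℕ) (σ : ℕ → Term) :
    (fun x => weight (consWeight n w) (upSub σ x)) = consWeight n fun x => weight w (σ x) := by
  funext x
  cases x with
  | zero => rfl
  | succ x => exact weight_lift _ _ _

theorem weight_subst (w : ℕ → ℕ) (σ : ℕ → Term) (t : Term) :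
    weight w (subst σ t) = weight (fun x => weight w (σ x)) t := by
  induction t generalizing w σ with
  | var x => rfl
  | lam t ih => simp only [subst, weight, ih, weight_upSub]
  | app t u iht ihu => simp only [subst, weight, iht, ihu]
  | jump t u iht ihu =>
    simp only [subst, weight, iht, ihu, weight_upSub, weight_zero]
    rfl

theorem mult_subst_upSub (σ : ℕ → Term) (t : Term) : mult (subst (upSub σ) t) = mult t := by
  rw [mult, weight_subst, weight_upSub]
  simp only [weight_zero]
  rfl

/-- Each occurrence of a variable, counted after unfolding, brings one copy of the potential of its
substitute. The weight function counts precisely these occurrences. -/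
theorem potential_subst (σ : ℕ → Term) (t : Term) :
    potential (subst σ t) = potential t + weight (fun x => potential (σ x)) t := by
  have hup : ∀ σ : ℕ → Term,
      (fun x => potential (upSub σ x)) = consWeight 0 fun x => potential (σ x) := by
    intro σ
    funext x
    cases x with
    | zero => rfl
    | succ x => exact potential_rename _ _
  induction t generalizing σ with
  | var x => exact (zero_add _).symm
  | lam t ih => simp only [subst, potential, weight, ih, hup]
  | app t u iht ihu =>
    simp only [subst, potential, weight, iht, ihu]
    omega
  | jump t u iht ihu =>
    simp only [subst, potential, weight_jump, iht, ihu, mult_subst_upSub, hup]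
    ring

theorem weight_inst (w : ℕ → ℕ) (t u : Term) :
    weight w (inst t u) =
      weight (consWeight 0 w) t + weight (consWeight 1 0) t * weight w u := by
  have h : (fun x => weight w (single u x)) =
      consWeight 0 w + fun x => weight w u * consWeight 1 0 x := by
    funext x
    cases x <;> simp [single, consWeight, weight]
  rw [inst, weight_subst, h, weight_add, weight_mul, mul_comm]

theorem potential_inst (t u : Term) :
    potential (inst t u) = potential t + weight (consWeight 1 0) t * potential u := by
  have h : (fun x => potential (single u x)) = fun x => potential u * consWeight 1 0 x := by
    funext x
    cases x <;> simp [single, consWeight, potential]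
  rw [inst, potential_subst, h, weight_mul, mul_comm]

/-- An occurrence inside the argument of a jump is not lost, even if the jump is void, since
multiplicities are at least one. -/
theorem one_le_weight {w : ℕ → ℕ} {x : ℕ} {t : Term} (hw : 1 ≤ w x) (hx : 0 < occ x t) :
    1 ≤ weight w t := by
  induction t generalizing w x with
  | var y =>
    by_cases hxy : y = x
    · subst hxy
      exact hw
    · simp [occ, hxy] at hx
  | lam t ih => exact ih (x := x + 1) hw hx
  | app t u iht ihu =>
    rcases Nat.add_pos_iff_pos_or_pos.1 hx with hx | hx
    · exact (iht hw hx).trans (Nat.le_add_right _ _)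
    · exact (ihu hw hx).trans (Nat.le_add_left _ _)
  | jump t u iht ihu =>
    rcases Nat.add_pos_iff_pos_or_pos.1 hx with hx | hx
    · exact (iht (x := x + 1) hw hx).trans (Nat.le_add_right _ _)
    · exact (show 1 ≤ mult t * weight w u from Nat.mul_pos (one_le_mult t) (ihu hw hx)).trans (Nat.le_add_left _ _)

theorem weight_swap (m n : ℕ) (w : ℕ → ℕ) (t : Term) :
    weight (consWeight m (consWeight n w)) (swap t) =
      weight (consWeight n (consWeight m w)) t := by
  rw [swap, weight_rename]
  congr 1
  funext x
  rcases x with _ | _ | x <;> rfl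

theorem weight_liftBelow (m n : ℕ) (w : ℕ → ℕ) (t : Term) :
    weight (consWeight m (consWeight n w)) (liftBelow t) = weight (consWeight m w) t := by
  rw [liftBelow, weight_rename, consWeight_comp_upRen, consWeight_comp_succ]

theorem mult_liftBelow (t : Term) : mult (liftBelow t) = mult t := mult_rename_upRen _ _

/-- Replacing `t` by `t'` increases neither the weights nor the potential. -/
def PotentialLe (t' t : Term) : Prop :=
  (∀ w, weight w t' ≤ weight w t) ∧ potential t' ≤ potential t

theorem PotentialLe.mult_le {t' t : Term} (h : PotentialLe t' t) : mult t' ≤ mult t :=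
  max_le_max le_rfl (h.1 _)

/-- All weights have to be controlled along with the potential: changing the body of a jump changes
its multiplicity, which scales the contribution of the argument. -/
theorem PotentialLe.ctx {R : Term → Term → Prop} (hR : ∀ t t', R t t' → PotentialLe t' t)
    {t t' : Term} (h : Ctx R t t') : PotentialLe t' t := by
  induction h with
  | hole h => exact hR _ _ h
  | appL v _ ih => exact ⟨fun w => Nat.add_le_add_right (ih.1 w) _, Nat.add_le_add_right ih.2 _⟩
  | appR v _ ih => exact ⟨fun w => Nat.add_le_add_left (ih.1 w) _, Nat.add_le_add_left ih.2 _⟩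
  | jumpR v _ ih =>
    exact ⟨fun w => Nat.add_le_add_left (Nat.mul_le_mul_left _ (ih.1 w)) _,
      Nat.add_le_add_left (Nat.mul_le_mul_left _ (Nat.add_le_add_left ih.2 _)) _⟩
  | jumpL v _ ih =>
    exact ⟨fun w => Nat.add_le_add (ih.1 _) (Nat.mul_le_mul_right _ ih.mult_le),
      Nat.add_le_add ih.2 (Nat.mul_le_mul_right _ ih.mult_le)⟩
  | lam _ ih => exact ⟨fun w => ih.1 _, ih.2⟩

/-- A strictly monotone interpretation of the term constructors that is compatible with `≡_CS`. -/
structure Interpretation where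
  lam : ℕ → ℕ
  app : ℕ → ℕ → ℕ
  jump : ℕ → ℕ → ℕ
  lam_lt {a b : ℕ} : a < b → lam a < lam b
  app_left {a b : ℕ} (c : ℕ) : a < b → app a c < app b c
  app_right {a b : ℕ} (c : ℕ) : a < b → app c a < app c b
  jump_left {a b : ℕ} (c : ℕ) : a < b → jump a c < jump b c
  jump_right {a b : ℕ} (c : ℕ) : a < b → jump c a < jump c b
  jump_comm (a b c : ℕ) : jump (jump a b) c = jump (jump a c) b

/-- The value of a term. -/
def Interpretation.eval (I : Interpretation) : Term → ℕ
  | .var _ => 0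
  | .lam t => I.lam (I.eval t)
  | .app t u => I.app (I.eval t) (I.eval u)
  | .jump t u => I.jump (I.eval t) (I.eval u)

theorem Interpretation.eval_rename (I : Interpretation) (ρ : ℕ → ℕ) (t : Term) :
    I.eval (rename ρ t) = I.eval t := by
  induction t generalizing ρ with
  | var x => rfl
  | lam t ih => simp only [rename, eval, ih]
  | app t u iht ihu => simp only [rename, eval, iht, ihu]
  | jump t u iht ihu => simp only [rename, eval, iht, ihu]

/-- Descent of the lexicographic measure `(potential, potential - numJumps, I.eval)`. -/
def Descends (I : Interpretation) (t t' : Term) : Prop :=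
  PotentialLe t' t ∧ (potential t' < potential t ∨ numJumps t < numJumps t' ∨
    numJumps t = numJumps t' ∧ I.eval t' < I.eval t)

theorem Descends.ctx {I : Interpretation} {R : Term → Term → Prop}
    (hR : ∀ t t', R t t' → Descends I t t') {t t' : Term} (h : Ctx R t t') :
    Descends I t t' := by
  refine ⟨PotentialLe.ctx (fun _ _ h => (hR _ _ h).1) h, ?_⟩
  induction h with
  | hole h => exact (hR _ _ h).2
  | @appL t t' v h ih =>
    simp only [potential, numJumps, Interpretation.eval]
    have := @I.app_left (I.eval t') (I.eval t) (I.eval v)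
    grind
  | @appR t t' v h ih =>
    simp only [potential, numJumps, Interpretation.eval]
    have := @I.app_right (I.eval t') (I.eval t) (I.eval v)
    grind
  | @jumpR t t' v h ih =>
    simp only [potential, numJumps, Interpretation.eval]
    have := @I.jump_right (I.eval t') (I.eval t) (I.eval v)
    have : potential t' < potential t →
        mult v * (1 + potential t') < mult v * (1 + potential t) := fun h =>
      Nat.mul_lt_mul_of_pos_left (by omega) (one_le_mult v)
    grind
  | @jumpL t t' v h ih =>
    have := Nat.mul_le_mul_right (1 + potential v)
      (PotentialLe.ctx (fun _ _ h => (hR _ _ h).1) h).mult_le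
    simp only [potential, numJumps, Interpretation.eval]
    have := @I.jump_left (I.eval t') (I.eval t) (I.eval v)
    grind
  | @lam t t' h ih =>
    simp only [potential, numJumps, Interpretation.eval]
    have := @I.lam_lt (I.eval t') (I.eval t)
    grind

theorem descends_w (I : Interpretation) (t u : Term) : Descends I (jump (lift t) u) t := by
  have hp : potential (lift t) = potential t := potential_rename _ _
  refine ⟨⟨fun w => ?_, ?_⟩, .inl ?_⟩
  · rw [weight_jump, weight_lift]
    exact Nat.le_add_right _ _
  · rw [potential, hp]
    exact Nat.le_add_right _ _
  -- A void jump still counts once, so erasing it is a strict decrease.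
  · rw [potential, mult_lift, hp]
    omega

theorem descends_d (I : Interpretation) (t u : Term) : Descends I (jump t u) (inst t u) := by
  have hm : weight (consWeight 1 0) t ≤ mult t := le_max_right _ _
  have hlt : potential (inst t u) < potential (jump t u) := by
    -- The summand `1` in `mult t * (1 + potential u)` accounts for the jump itself. It disappears
    -- with the jump and makes the inequality strict, whatever the number of occurrences.
    rw [potential_inst, potential]
    have := Nat.mul_le_mul_right (potential u) hm
    have := one_le_mult t
    rw [mul_add]
    omega
  refine ⟨⟨fun w => ?_, hlt.le⟩, .inl hlt⟩
  rw [weight_inst, weight_jump]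
  exact Nat.add_le_add_left (Nat.mul_le_mul_right _ hm) _

theorem descends_c (I : Interpretation) {t t' : Term} (u : Term) (h : IsSplit t t') :
    Descends I (jump t u) (jump (jump t' (lift u)) u) := by
  obtain ⟨rfl, h₀, h₁⟩ := h
  have hw : ∀ w : ℕ → ℕ, weight (consWeight 0 w) (rename mergeIdx t') =
      weight (consWeight 0 (consWeight 0 w)) t' := by
    intro w
    rw [weight_rename]
    congr 1
    funext x
    rcases x with _ | _ | x <;> rfl
  have hsum : weight (consWeight 1 0) (rename mergeIdx t') =
      weight (consWeight 1 0) t' + weight (consWeight 0 (consWeight 1 0)) t' := by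
    rw [weight_rename, ← weight_add]
    congr 1
    funext x
    rcases x with _ | _ | x <;> rfl
  have h₀' : 1 ≤ weight (consWeight 1 0) t' := one_le_weight (x := 0) le_rfl h₀
  have h₁' : 1 ≤ weight (consWeight 0 (consWeight 1 0)) t' := one_le_weight (x := 1) le_rfl h₁
  -- Both variables occur, so neither maximum with `1` is attained by default and the multiplicities
  -- of the two new jumps add up to the old one exactly.
  have hm : mult (rename mergeIdx t') = mult t' + mult (jump t' (lift u)) := by
    simp only [mult, weight, weight_lift, weight_zero, hsum]
    rw [mul_zero, add_zero, max_eq_right h₀', max_eq_right h₁', max_eq_right (by omega)]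
  have hu : potential (lift u) = potential u := potential_rename _ _
  have hp : potential (rename mergeIdx t') = potential t' := potential_rename _ _
  refine ⟨⟨fun w => ?_, ?_⟩, .inr (.inl ?_)⟩
  · simp only [weight_jump, weight_lift, hw, hm]
    rw [add_mul, add_assoc]
  · simp only [potential, hp, hm, hu]
    rw [add_mul, add_assoc]
  · have hu : numJumps (lift u) = numJumps u := numJumps_rename _ _
    have hp : numJumps (rename mergeIdx t') = numJumps t' := numJumps_rename _ _
    simp only [numJumps, hp, hu]
    omega

theorem mult_lam_swap (t : Term) : mult (lam (swap t)) = max 1 (weight (consWeight 1 0) t) := by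
  rw [mult, weight, weight_swap, consWeight_zero_zero]

theorem InRule.potentialLe {t t' : Term} (h : InRule t t') :
    PotentialLe t' t ∧ numJumps t = numJumps t' := by
  have hp : ∀ t, potential (lift t) = potential t := fun t => potential_rename _ t
  have hn : ∀ t, numJumps (lift t) = numJumps t := fun t => numJumps_rename _ t
  cases h with
  | in1 t u =>
    have hm : mult (swap t) = mult (lam t) := by
      rw [mult, mult, weight, ← weight_swap, consWeight_zero_zero]
    have hps : potential (swap t) = potential t := potential_rename _ t
    have hns : numJumps (swap t) = numJumps t := numJumps_rename _ t
    refine ⟨⟨fun w => ?_, ?_⟩, ?_⟩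
    · simp only [weight_lam, weight_jump, weight_lift, weight_swap, hm, le_refl]
    · simp only [potential, hp, hps, hm, le_refl]
    · simp only [numJumps, hn, hns]
  | in2 t v u =>
    have hm : mult (app t (lift v)) = mult t := by
      simp only [mult, weight, weight_lift, weight_zero, add_zero]
    refine ⟨⟨fun w => ?_, ?_⟩, ?_⟩
    · simp only [weight_jump, weight_app, weight_lift, hm]
      omega
    · simp only [potential, hp, hm]
      omega
    · simp only [numJumps, hn]
      omega
  | in3 t v u _ =>
    have hm : mult (app (lift t) v) = mult v := by
      simp only [mult, weight, weight_lift, weight_zero, zero_add]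
    refine ⟨⟨fun w => ?_, ?_⟩, ?_⟩
    · simp only [weight_jump, weight_app, weight_lift, hm]
      omega
    · simp only [potential, hp, hm]
      omega
    · simp only [numJumps, hn]
      omega
  | in4 t v u hocc =>
    have hv : 1 ≤ weight (consWeight 1 0) v := one_le_weight (x := 0) le_rfl hocc
    -- Equality rests on the occurrence of `x` in `v`: for a void jump the left side would be `1`,
    -- possibly less than `mult t`.
    have hm : mult (jump (liftBelow t) v) = mult t * mult v := by
      rw [mult, weight_jump, weight_liftBelow, consWeight_zero_zero, weight_zero, zero_add,
        mult_liftBelow, mult, mult, max_eq_right hv, max_eq_right]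
      exact Nat.mul_pos (one_le_mult t) hv
    have hpl : potential (liftBelow t) = potential t := potential_rename _ t
    have hnl : numJumps (liftBelow t) = numJumps t := numJumps_rename _ t
    refine ⟨⟨fun w => le_of_eq ?_, le_of_eq ?_⟩, ?_⟩
    · simp only [weight_jump, weight_liftBelow, mult_liftBelow, hm]
      ring
    · simp only [potential, mult_liftBelow, hpl, hm]
      ring
    · simp only [numJumps, hnl]
      omega

theorem OutRule.potentialLe {t t' : Term} (h : OutRule t t') :
    PotentialLe t' t ∧ numJumps t = numJumps t' := by
  have hp : ∀ t, potential (lift t) = potential t := fun t => potential_rename _ t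
  have hn : ∀ t, numJumps (lift t) = numJumps t := fun t => numJumps_rename _ t
  cases h with
  | out1 t u =>
    have hm : mult (lam (swap t)) = mult t := mult_lam_swap t
    have hps : potential (swap t) = potential t := potential_rename _ t
    have hns : numJumps (swap t) = numJumps t := numJumps_rename _ t
    refine ⟨⟨fun w => ?_, ?_⟩, ?_⟩
    · simp only [weight_lam, weight_jump, weight_lift, weight_swap, hm, le_refl]
    · simp only [potential, hp, hps, hm, le_refl]
    · simp only [numJumps, hn, hns]
  | out2 t u v =>
    have hm : mult (app t (lift v)) = mult t := by
      simp only [mult, weight, weight_lift, weight_zero, add_zero]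
    refine ⟨⟨fun w => ?_, ?_⟩, ?_⟩
    · simp only [weight_jump, weight_app, weight_lift, hm]
      omega
    · simp only [potential, hp, hm]
      omega
    · simp only [numJumps, hn]
      omega
  | out3 t v u =>
    have hm : mult (app (lift t) v) = mult v := by
      simp only [mult, weight, weight_lift, weight_zero, zero_add]
    refine ⟨⟨fun w => ?_, ?_⟩, ?_⟩
    · simp only [weight_jump, weight_app, weight_lift, hm]
      omega
    · simp only [potential, hp, hm]
      omega
    · simp only [numJumps, hn]
      omega
  | out4 t v u =>
    -- For `out4` only this direction matters, and it holds even when `x` does not occur in `v`.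
    have hm : mult (jump (liftBelow t) v) ≤ mult t * mult v := by
      rw [mult, weight_jump, weight_liftBelow, consWeight_zero_zero, weight_zero, zero_add,
        mult_liftBelow]
      exact max_le (Nat.mul_pos (one_le_mult t) (one_le_mult v))
        (Nat.mul_le_mul_left _ (le_max_right _ _))
    have hpl : potential (liftBelow t) = potential t := potential_rename _ t
    have hnl : numJumps (liftBelow t) = numJumps t := numJumps_rename _ t
    refine ⟨⟨fun w => ?_, ?_⟩, ?_⟩
    · simp only [weight_jump, weight_liftBelow, mult_liftBelow]
      have := Nat.mul_le_mul_right (weight w u) hm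
      rw [mul_add, ← mul_assoc]
      omega
    · simp only [potential, mult_liftBelow, hpl]
      have := Nat.mul_le_mul_right (1 + potential u) hm
      have h : mult t * (1 + (potential v + mult v * (1 + potential u))) =
          mult t * (1 + potential v) + mult t * mult v * (1 + potential u) := by ring
      omega
    · simp only [numJumps, hnl]
      omega

/-- All parts of the lexicographic measure agree. -/
structure SameMeasure (I : Interpretation) (t t' : Term) : Prop where
  weight_eq (w : ℕ → ℕ) : weight w t = weight w t'
  potential_eq : potential t = potential t'
  numJumps_eq : numJumps t = numJumps t'
  eval_eq : I.eval t = I.eval t'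

theorem SameMeasure.mult_eq {I : Interpretation} {t t' : Term} (h : SameMeasure I t t') :
    mult t = mult t' := by
  rw [mult, h.weight_eq, mult]

theorem CSRule.sameMeasure (I : Interpretation) {t t' : Term} (h : CSRule t t') :
    SameMeasure I t t' := by
  obtain ⟨t, s, v⟩ := h
  have hp : ∀ t, potential (lift t) = potential t := fun t => potential_rename _ t
  have hps : potential (swap t) = potential t := potential_rename _ t
  have hn : ∀ t, numJumps (lift t) = numJumps t := fun t => numJumps_rename _ t
  have hns : numJumps (swap t) = numJumps t := numJumps_rename _ t
  have h₁ : mult (jump (swap t) (lift v)) = mult t := by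
    rw [mult, weight_jump, weight_lift, weight_zero, mul_zero, add_zero, weight_swap,
      consWeight_zero_zero, mult]
  have h₂ : mult (jump t (lift s)) = mult (swap t) := by
    rw [mult, weight_jump, weight_lift, weight_zero, mul_zero, add_zero, ← weight_swap,
      consWeight_zero_zero, mult]
  refine ⟨fun w => ?_, ?_, ?_, ?_⟩
  · rw [weight_jump, weight_jump, weight_jump, weight_jump, h₁, h₂, weight_lift, weight_lift,
      weight_swap]
    omega
  · simp only [potential, h₁, h₂, hp, hps]
    omega
  · simp only [numJumps, hn, hns]
    omega
  · simp only [Interpretation.eval, lift, swap, I.eval_rename]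
    exact I.jump_comm _ _ _

theorem CSEquiv.sameMeasure (I : Interpretation) {t t' : Term} (h : CSEquiv t t') :
    SameMeasure I t t' := by
  have hctx : ∀ {t t' : Term}, Ctx CSRule t t' → SameMeasure I t t' := by
    intro t t' h
    induction h with
    | hole h => exact h.sameMeasure I
    | appL v _ ih =>
      constructor <;> intros <;>
        simp only [weight_app, potential, numJumps, Interpretation.eval, ih.weight_eq,
          ih.potential_eq, ih.numJumps_eq, ih.eval_eq]
    | appR v _ ih =>
      constructor <;> intros <;>
        simp only [weight_app, potential, numJumps, Interpretation.eval, ih.weight_eq,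
          ih.potential_eq, ih.numJumps_eq, ih.eval_eq]
    | jumpR v _ ih =>
      constructor <;> intros <;>
        simp only [weight_jump, potential, numJumps, Interpretation.eval, ih.weight_eq,
          ih.potential_eq, ih.numJumps_eq, ih.eval_eq]
    | jumpL v _ ih =>
      constructor <;> intros <;>
        simp only [weight_jump, potential, numJumps, Interpretation.eval, ih.weight_eq,
          ih.potential_eq, ih.numJumps_eq, ih.eval_eq, ih.mult_eq]
    | lam _ ih =>
      constructor <;> intros <;>
        simp only [weight_lam, potential, numJumps, Interpretation.eval, ih.weight_eq,
          ih.potential_eq, ih.numJumps_eq, ih.eval_eq]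
  induction h with
  | rel _ _ h => exact hctx h
  | refl => exact ⟨fun _ => rfl, rfl, rfl, rfl⟩
  | symm _ _ _ ih =>
    exact ⟨fun w => (ih.1 w).symm, ih.2.symm, ih.3.symm, ih.4.symm⟩
  | trans _ _ _ _ _ ih₁ ih₂ =>
    exact ⟨fun w => (ih₁.1 w).trans (ih₂.1 w), ih₁.2.trans ih₂.2, ih₁.3.trans ih₂.3,
      ih₁.4.trans ih₂.4⟩

/-- The interpretation that decreases along the inner propagation rules. -/
def innerInterpretation : Interpretation where
  lam a := a + 1
  app a b := a + b + 2
  -- One more than this value is `(a + 1) * (b + 2)`. Successive jumps thus multiply, hence commute,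
  -- and a jump costs less on a smaller body.
  jump a b := a * b + 2 * a + b + 1
  lam_lt h := by omega
  app_left c h := by omega
  app_right c h := by omega
  jump_left c h := by
    have := Nat.mul_le_mul_right c h.le
    omega
  jump_right c h := by
    have := Nat.mul_le_mul_left c h.le
    omega
  jump_comm a b c := by ring

/-- The interpretation that decreases along the outer propagation rules. -/
def outerInterpretation : Interpretation where
  -- Every position from which a jump can move out doubles its value, while the body of a jump
  -- enters with coefficient one; moving out therefore saves.
  lam a := 2 * a + 1
  app a b := 2 * a + 2 * b + 3
  jump a b := a + 2 * b + 2
  lam_lt h := by omega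
  app_left c h := by omega
  app_right c h := by omega
  jump_left c h := by omega
  jump_right c h := by omega
  jump_comm a b c := by omega

theorem InRule.descends {t t' : Term} (h : InRule t t') :
    Descends innerInterpretation t t' := by
  obtain ⟨h₁, h₂⟩ := h.potentialLe
  refine ⟨h₁, .inr (.inr ⟨h₂, ?_⟩)⟩
  cases h <;> simp only [Interpretation.eval, lift, swap, liftBelow, Interpretation.eval_rename] <;>
    simp only [innerInterpretation] <;> nlinarith

theorem OutRule.descends {t t' : Term} (h : OutRule t t') :
    Descends outerInterpretation t t' := by
  obtain ⟨h₁, h₂⟩ := h.potentialLe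
  refine ⟨h₁, .inr (.inr ⟨h₂, ?_⟩)⟩
  cases h <;> simp only [Interpretation.eval, lift, swap, liftBelow, Interpretation.eval_rename] <;>
    simp only [outerInterpretation] <;> omega

/-- The lexicographic measure. -/
def lexMeasure (I : Interpretation) (t : Term) : ℕ ×ₗ ℕ ×ₗ ℕ :=
  toLex (potential t, toLex (potential t - numJumps t, I.eval t))

/-- Subtraction turns growth of the number of jumps into descent; it is not truncated, because
`numJumps` never exceeds `potential`. -/
theorem Descends.lexMeasure_lt {I : Interpretation} {t t' : Term} (h : Descends I t t') :
    lexMeasure I t' < lexMeasure I t := by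
  obtain ⟨⟨-, hp⟩, h⟩ := h
  have hn := numJumps_le_potential t
  have hn' := numJumps_le_potential t'
  simp only [lexMeasure, Prod.Lex.toLex_lt_toLex]
  omega

theorem SameMeasure.lexMeasure_eq {I : Interpretation} {t t' : Term} (h : SameMeasure I t t') :
    lexMeasure I t = lexMeasure I t' := by
  rw [lexMeasure, lexMeasure, h.potential_eq, h.numJumps_eq, h.eval_eq]

end Termination

/-! ### Combining the counter with the measure. -/

theorem Ctx.or {R S : Term → Term → Prop} {t t' : Term} (h : Ctx (fun t t' => R t t' ∨ S t t') t t') :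
    Ctx R t t' ∨ Ctx S t t' := by
  induction h with
  | hole h => exact h.imp .hole .hole
  | appL v _ ih => exact ih.imp (.appL v) (.appL v)
  | appR v _ ih => exact ih.imp (.appR v) (.appR v)
  | jumpR v _ ih => exact ih.imp (.jumpR v) (.jumpR v)
  | jumpL v _ ih => exact ih.imp (.jumpL v) (.jumpL v)
  | lam _ ih => exact ih.imp .lam .lam

theorem Ctx.mono {R S : Term → Term → Prop} (hRS : ∀ t t', R t t' → S t t') {t t' : Term}
    (h : Ctx R t t') : Ctx S t t' := by
  induction h with
  | hole h => exact .hole (hRS _ _ h)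
  | appL v _ ih => exact .appL v ih
  | appR v _ ih => exact .appR v ih
  | jumpR v _ ih => exact .jumpR v ih
  | jumpL v _ ih => exact .jumpL v ih
  | lam _ ih => exact .lam ih

theorem CoreRule.typLe_or_descends (I : Interpretation) {t t' : Term} (h : CoreRule t t') :
    TypLe 1 t t' ∨ TypLe 0 t t' ∧ Descends I t t' := by
  cases h with
  | dB t L u => exact .inl (dB_typLe t L u)
  | w _ u => exact .inr ⟨w_typLe _ u, descends_w I _ u⟩
  | d t u _ => exact .inr ⟨d_typLe t u, descends_d I t u⟩
  | c t t' u _ h => exact .inr ⟨c_typLe u h, descends_c I u h⟩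

/-- If each rule lowers the counter of typings or the lexicographic measure, then typed terms are
strongly normalizing. -/
theorem Typ.acc {I : Interpretation} {R : Term → Term → Prop}
    (hR : ∀ t t', R t t' → TypLe 1 t t' ∨ TypLe 0 t t' ∧ Descends I t t') {t : Term} {K : Res}
    {A : Ty} (h : Typ t K A) : Acc (fun a b => Modulo (Ctx R) CSEquiv b a) t := by
  -- The outer induction on the counter handles steps such as `dB`, after which the lexicographic
  -- measure may be arbitrarily larger.
  induction hn : K.2 using Nat.strong_induction_on generalizing t K with
  | _ n ihn =>
  -- Here `K` stays fixed: the remaining steps preserve a typing with the same resources.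
  induction hm : lexMeasure I t using WellFoundedLT.induction generalizing t with
  | _ m ihm =>
  refine ⟨_, ?_⟩
  rintro t' ⟨s, s', hs, hstep, hs'⟩
  have hK := hs.typ_iff.1 h
  rcases (hstep.mono hR).or with hstep | hstep
  · obtain ⟨G, hG, hG'⟩ := TypLe.ctx (fun _ _ h => h) hstep K A hK
    have hlt : G.2 + 1 ≤ K.2 := hG.2
    exact ihn G.2 (by omega) (hs'.typ_iff.1 hG') rfl
  · have hlt := (Descends.ctx (I := I) (fun _ _ h => h.2) hstep).lexMeasure_lt
    rw [← (hs.sameMeasure I).lexMeasure_eq, (hs'.sameMeasure I).lexMeasure_eq, hm] at hlt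
    exact ihm _ hlt (hs'.typ_iff.1 ((TypLe.ctx (fun _ _ h => h.1) hstep).typ hK)) rfl

theorem psn_of_typLe_or_descends {I : Interpretation} {R : Term → Term → Prop}
    (hR : ∀ t t', R t t' → TypLe 1 t t' ∨ TypLe 0 t t' ∧ Descends I t t') :
    PSN (Modulo (Ctx R) CSEquiv) := by
  intro t ht h
  obtain ⟨K, A, hK⟩ := h.typable ht
  exact .of_acc (hK.acc hR)

theorem psn_innerRed : PSN InnerRed :=
  psn_of_typLe_or_descends (I := innerInterpretation) fun _ _ h => h.elim
    (CoreRule.typLe_or_descends _) fun h => .inr ⟨h.typLe, h.descends⟩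

theorem psn_outerRed : PSN OuterRed :=
  psn_of_typLe_or_descends (I := outerInterpretation) fun _ _ h => h.elim
    (CoreRule.typLe_or_descends _) fun h => .inr ⟨h.typLe, h.descends⟩

end StructuralLambda

theorem mainTheorem10 :
    StructuralLambda.PSN StructuralLambda.InnerRed ∧
      StructuralLambda.PSN StructuralLambda.OuterRed :=
  ⟨StructuralLambda.psn_innerRed, StructuralLambda.psn_outerRed⟩
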